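/- Let $(\Omega,\mathcal F,P)$ be a probability space, $\Phi\subseteq\mathbb R^k$, and let $\varphi_0$ be an interior point of $\Phi$. For each integer $n\ge 0$ let $Q_n(\varphi)$, $\varphi\in\mathbb R^k$, be a real random function that is three times continuously differentiable in $\varphi$. Let $\Omega_S$ and $\Omega_I$ be symmetric positive definite $k\times k$ matrices, let $B$ be a $k$-dimensional standard Brownian motion, let $N(\varphi_0)$ be a neighbourhood of $\varphi_0$, and let $0<\tau<\infty$ be a constant. Assume that, as $n\to\infty$: (C.1) the processes $t\mapsto n^{-1/2}\,\partial Q_{\lfloor nt\rfloor}(\varphi_0)/\partial\varphi$, $t\ge 0$, converge weakly in the Skorokhod space $D([0,\infty),\mathbb R^k)$ to $\Omega_S^{1/2}B$; (C.2) $-n^{-1}\,\partial^2Q_n(\varphi_0)/\partial\varphi\,\partial\varphi'\to\Omega_I$ almost surely; (C.3) there are random variables $\tau_n$ with $\tau_n\to\tau$ almost surely such that, almost surely for all $n\ge1$, $$\max_{h,i,j=1,\dots,k}\ \sup_{\varphi\in N(\varphi_0)}\left|n^{-1}\frac{\partial^3Q_n(\varphi)}{\partial\varphi_h\,\partial\varphi_i\,\partial\varphi_j}\right|\le\tau_n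 .$$ Let $n(t)$, $t\ge0$, be a counting process on the same probability space (integer valued, nonnegative, nondecreasing in $t$), not assumed independent of the $Q_n$, and assume that for a constant $c\in(0,\infty)$: (C.4) $n(T)/T\to c$ almost surely as $T\to\infty$. Then there are a fixed (non-random) open set $U$ with $\varphi_0\in U\subseteq N(\varphi_0)\cap\Phi$ and random vectors $\hat\varphi_T$ in $\mathbb R^k$, $T\ge 0$, such that, as $T\to\infty$: (i) with probability tending to one, $Q_{n(T)}$ is concave on $U$, $\hat\varphi_T\in U$ is its unique maximum point in $U$, and $\partial Q_{n(T)}(\hat\varphi_T)/\partial\varphi=0$; (ii) $\hat\varphi_T\to\varphi_0$ in probability; (iii) $T^{1/2}(\hat\varphi_T-\varphi_0)\to N(0,\Sigma)$ in distribution, where $\Sigma=c^{-1}\,\Omega_I^{-1}\Omega_S\Omega_I^{-1}$. -/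

import Mathlib

open MeasureTheory ProbabilityTheory Filter Topology
open scoped NNReal Matrix MatrixOrder

/-! ### The Skorokhod space `D([0, ∞), E)` -/

/-- Càdlàg functions `[0, ∞) → E`. -/
structure SkorokhodSpace (E : Type*) [TopologicalSpace E] where
  toFun : ℝ≥0 → E
  right_continuous : ∀ t, ContinuousWithinAt toFun (Set.Ici t) t
  left_limit : ∀ t, ∃ l, Tendsto toFun (𝓝[<] t) (𝓝 l)

namespace SkorokhodSpace

/-- Convergence of a sequence in the Skorokhod `J₁` topology on `D([0, ∞), E)`: there are
time changes `lam n` (increasing bijections of `[0, ∞)`) with `sup_s |lam n s - s| → 0` and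
`sup_{s ≤ M} |u n (lam n s) - x s| → 0` for every `M`. -/
def SeqTendsto {E : Type*} [PseudoMetricSpace E] (u : ℕ → SkorokhodSpace E)
    (x : SkorokhodSpace E) : Prop :=
  ∃ lam : ℕ → (ℝ≥0 ≃o ℝ≥0),
    TendstoUniformly (fun n s => lam n s) (fun s => s) atTop ∧
    ∀ M : ℝ≥0, TendstoUniformlyOn (fun n s => (u n).toFun (lam n s)) x.toFun atTop (Set.Iic M)

/-- The Skorokhod `J₁` topology. It is metrizable, hence it is the topology whose open sets are
the sequentially open sets for `J₁`-convergence of sequences. -/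
instance {E : Type*} [PseudoMetricSpace E] : TopologicalSpace (SkorokhodSpace E) where
  IsOpen s := ∀ x ∈ s, ∀ u : ℕ → SkorokhodSpace E, SeqTendsto u x → ∀ᶠ n in atTop, u n ∈ s
  isOpen_univ := fun _ _ _ _ => Eventually.of_forall fun _ => trivial
  isOpen_inter := fun _ _ hs ht x hx u hu => (hs x hx.1 u hu).and (ht x hx.2 u hu)
  isOpen_sUnion := by
    rintro S hS x ⟨s, hs, hxs⟩ u hu
    exact (hS s hs x hxs u hu).mono fun n hn => ⟨s, hs, hn⟩

instance {E : Type*} [PseudoMetricSpace E] : MeasurableSpace (SkorokhodSpace E) :=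
  borel (SkorokhodSpace E)

instance {E : Type*} [PseudoMetricSpace E] : BorelSpace (SkorokhodSpace E) := ⟨rfl⟩

/-- A continuous path as an element of `D([0, ∞), E)`. -/
def ofContinuous {E : Type*} [TopologicalSpace E] (f : ℝ≥0 → E) (hf : Continuous f) :
    SkorokhodSpace E where
  toFun := f
  right_continuous := fun _ => hf.continuousWithinAt
  left_limit := fun t => ⟨f t, (hf.tendsto t).mono_left nhdsWithin_le_nhds⟩

/-- The step path `t ↦ y ⌊n t⌋` of a sequence `y`. -/
noncomputable def step {E : Type*} [TopologicalSpace E] (n : ℕ) (y : ℕ → E) :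
    SkorokhodSpace E where
  toFun := fun t => y ⌊(n : ℝ≥0) * t⌋₊
  right_continuous := by
    intro t
    have h1 : ∀ᶠ s in 𝓝[≥] t, (n : ℝ≥0) * s < (⌊(n : ℝ≥0) * t⌋₊ : ℝ≥0) + 1 :=
      ((continuous_const.mul continuous_id).continuousAt.eventually_lt continuousAt_const
        (Nat.lt_floor_add_one _)).filter_mono nhdsWithin_le_nhds
    refine (tendsto_const_nhds (x := y ⌊(n : ℝ≥0) * t⌋₊)).congr' ?_
    filter_upwards [h1, self_mem_nhdsWithin] with s hs hts
    have : ⌊(n : ℝ≥0) * s⌋₊ = ⌊(n : ℝ≥0) * t⌋₊ := by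
      rw [Nat.floor_eq_iff zero_le]
      exact ⟨(Nat.floor_le zero_le).trans (mul_le_mul_right hts _), hs⟩
    rw [this]
  left_limit := by
    intro t
    have hmono : Monotone fun s : ℝ≥0 => ⌊(n : ℝ≥0) * s⌋₊ :=
      fun a b hab => Nat.floor_mono (mul_le_mul_right hab _)
    exact ⟨_, (continuous_of_discreteTopology (f := y)).continuousAt.tendsto.comp
      (hmono.tendsto_nhdsLT t)⟩

end SkorokhodSpace

/-! ### Brownian motion and counting processes -/

/-- A `k`-dimensional standard Brownian motion: independent one-dimensional standard Brownian
motions as coordinates, with continuous paths. -/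
structure IsBrownianMotion {k : ℕ} {Ω : Type*} [MeasurableSpace Ω]
    (B : ℝ≥0 → Ω → EuclideanSpace ℝ (Fin k)) (P : Measure Ω) : Prop where
  coord : ∀ i, IsBrownianReal (fun t ω => B t ω i) P
  indep : iIndepFun (fun (i : Fin k) ω (t : ℝ≥0) => B t ω i) P
  continuous_paths : ∀ ω, Continuous fun t => B t ω

/-- The path of `Ω_S^{1/2} B`, where `Ω_S^{1/2}` is the positive semidefinite square root. -/
noncomputable def brownianLimitPath {k : ℕ} {Ω : Type*} [MeasurableSpace Ω] {P : Measure Ω}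
    {B : ℝ≥0 → Ω → EuclideanSpace ℝ (Fin k)} (hB : IsBrownianMotion B P)
    (S : Matrix (Fin k) (Fin k) ℝ) (ω : Ω) : SkorokhodSpace (EuclideanSpace ℝ (Fin k)) :=
  SkorokhodSpace.ofContinuous (fun t => Matrix.toEuclideanCLM (𝕜 := ℝ) (CFC.sqrt S) (B t ω))
    ((Matrix.toEuclideanCLM (𝕜 := ℝ) (CFC.sqrt S)).continuous.comp (hB.continuous_paths ω))

/-- A counting process: nonnegative integer valued random variables, nondecreasing in time. -/
structure IsCountingProcess {Ω : Type*} [MeasurableSpace Ω] (n : ℝ≥0 → Ω → ℕ) : Prop where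
  measurable : ∀ t, Measurable (n t)
  monotone_paths : ∀ ω, Monotone fun t => n t ω

/-! ### Derivatives of a criterion function -/

/-- The path `t ↦ n^{-1/2} ∂Q_{⌊n t⌋}(x) / ∂φ` for a sequence of functions `Q`. -/
noncomputable def scorePath {k : ℕ} (Q : ℕ → EuclideanSpace ℝ (Fin k) → ℝ)
    (x : EuclideanSpace ℝ (Fin k)) (n : ℕ) : SkorokhodSpace (EuclideanSpace ℝ (Fin k)) :=
  SkorokhodSpace.step n fun m => (√(n : ℝ))⁻¹ • gradient (Q m) x

/-- The matrix `∂²f(x) / ∂φ ∂φ'`. -/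
noncomputable def hessianMatrix {k : ℕ} (f : EuclideanSpace ℝ (Fin k) → ℝ)
    (x : EuclideanSpace ℝ (Fin k)) : Matrix (Fin k) (Fin k) ℝ :=
  Matrix.of fun i j =>
    iteratedFDeriv ℝ 2 f x ![EuclideanSpace.single i 1, EuclideanSpace.single j 1]

/-- The partial derivative `∂³f(x) / ∂φ_h ∂φ_i ∂φ_j`. -/
noncomputable def thirdPartial {k : ℕ} (f : EuclideanSpace ℝ (Fin k) → ℝ)
    (x : EuclideanSpace ℝ (Fin k)) (h i j : Fin k) : ℝ :=
  iteratedFDeriv ℝ 3 f x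
    ![EuclideanSpace.single h 1, EuclideanSpace.single i 1, EuclideanSpace.single j 1]

/-!
The criterion function is, after division by `n`, locally a small perturbation of a concave
quadratic: since the Hessians at `φ₀` converge and the third derivatives are bounded, for every
`ε > 0` there is a fixed ball around `φ₀` on which, almost surely for all large `n`, the map
`g = -n⁻¹ ∂Q_n` satisfies `‖g x - g y - Ω_I (x - y)‖ ≤ ε ‖x - y‖`, that is
`ApproximatesLinearOn g Ω_I (ball φ₀ r) ε`
(`exists_ball_forall_eventually_approximatesLinearOn`). If `κ` is a lower bound for the quadratic
form of `Ω_I` and `ε < κ`, this alone makes `Q_n` concave on the ball with at most one critical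
point, and, when `g φ₀` is small, gives a critical point near `φ₀`, with
`‖φ̂ - φ₀‖ ≤ (κ - ε)⁻¹ ‖g φ₀‖`. The inequality with `x = φ̂`, `y = φ₀` and `ε → 0` says that
`φ̂ - φ₀` equals `-Ω_I⁻¹ g φ₀` up to an error that is negligible with respect to `‖g φ₀‖`. Almost
sure statements along `n → ∞` hold along the random index `n(T)`, since `n(T) → ∞`.

The probabilistic part is the limit law of the score at the random index
(`tendstoInDistribution_random_time`, `tendstoInDistribution_random_index`). Evaluation at a time is
not continuous on the Skorokhod space, but for a continuous weight `g` with compact support and a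
nonnegative bounded uniformly continuous `F` the functional `x ↦ sup_t g(t) F(x(t))` is. If `g = 1`
near `c`, it dominates `F` at any random time close to `c`; letting `g` shrink to `c` bounds the
limit superior of `E F(X_n(V_n))` by `E F(W(c))`. Applied to `F` and to a constant minus `F` this
gives convergence in distribution, without any independence between the process and the random time.
The limit `c⁻¹ Ω_I⁻¹ Ω_S^{1/2} B(c)` is identified by its characteristic function.
-/

/-! ### Continuous functionals on the Skorokhod space -/

namespace SkorokhodSpace

/-- The topology of `SkorokhodSpace E` is defined by its convergent sequences, so sequential
continuity implies continuity. -/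
lemma continuous_of_seqTendsto {E Y : Type*} [PseudoMetricSpace E] [TopologicalSpace Y]
    {f : SkorokhodSpace E → Y}
    (hf : ∀ u x, SeqTendsto u x → Tendsto (fun n => f (u n)) atTop (𝓝 (f x))) :
    Continuous f :=
  ⟨fun _ hV x hx u hu => hf u x hu (hV.mem_nhds hx)⟩

/-- The weighted supremum `sup_t g(t) F(x(t))` of a path `x`. Unlike the evaluation at a fixed
time it depends continuously on the path for the `J₁` topology. -/
noncomputable def weightedSup {E : Type*} [TopologicalSpace E] (g : ℝ≥0 → ℝ) (F : E → ℝ)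
    (x : SkorokhodSpace E) : ℝ :=
  ⨆ t, g t * F (x.toFun t)

section weightedSup

variable {E : Type*} {g : ℝ≥0 → ℝ} {F : E → ℝ} {C : ℝ}

lemma bddAbove_weightedSup [TopologicalSpace E] (hg1 : ∀ t, g t ≤ 1) (hF0 : ∀ x, 0 ≤ F x)
    (hFC : ∀ x, F x ≤ C) (x : SkorokhodSpace E) :
    BddAbove (Set.range fun t => g t * F (x.toFun t)) := by
  refine ⟨C, ?_⟩
  rintro _ ⟨t, rfl⟩
  exact (mul_le_of_le_one_left (hF0 _) (hg1 t)).trans (hFC _)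

lemma weightedSup_nonneg [TopologicalSpace E] (hg0 : ∀ t, 0 ≤ g t) (hF0 : ∀ x, 0 ≤ F x)
    (x : SkorokhodSpace E) : 0 ≤ weightedSup g F x :=
  Real.iSup_nonneg fun t => mul_nonneg (hg0 t) (hF0 _)

lemma weightedSup_le [TopologicalSpace E] (hg1 : ∀ t, g t ≤ 1) (hF0 : ∀ x, 0 ≤ F x)
    (hFC : ∀ x, F x ≤ C) (x : SkorokhodSpace E) : weightedSup g F x ≤ C :=
  ciSup_le fun t => (mul_le_of_le_one_left (hF0 _) (hg1 t)).trans (hFC _)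

lemma le_weightedSup [TopologicalSpace E] (hg1 : ∀ t, g t ≤ 1) (hF0 : ∀ x, 0 ≤ F x)
    (hFC : ∀ x, F x ≤ C) (x : SkorokhodSpace E) {t : ℝ≥0} (ht : g t = 1) :
    F (x.toFun t) ≤ weightedSup g F x := by
  have h := le_ciSup (bddAbove_weightedSup hg1 hF0 hFC x) t
  rwa [ht, one_mul] at h

lemma continuous_weightedSup [PseudoMetricSpace E] (hg : UniformContinuous g)
    (hg0 : ∀ t, 0 ≤ g t) (hg1 : ∀ t, g t ≤ 1) {R : ℝ≥0} (hgR : ∀ t, R ≤ t → g t = 0)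
    (hF : UniformContinuous F) (hF0 : ∀ x, 0 ≤ F x) (hFC : ∀ x, F x ≤ C) :
    Continuous (weightedSup g F) := by
  refine continuous_of_seqTendsto fun u x ⟨lam, hlam, hu⟩ => ?_
  rw [Metric.tendsto_atTop']
  intro ε hε
  have hC0 : 0 ≤ C := (hF0 _).trans (hFC (x.toFun 0))
  obtain ⟨d₁, hd₁, h₁⟩ := Metric.uniformContinuous_iff.1 hg (ε / (4 * (C + 1))) (by positivity)
  obtain ⟨d₂, hd₂, h₂⟩ := Metric.uniformContinuous_iff.1 hF (ε / 4) (by positivity)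
  have e₁ := Metric.tendstoUniformly_iff.1 hlam (min d₁ 1) (by positivity)
  have e₂ := Metric.tendstoUniformlyOn_iff.1 (hu (R + 1)) d₂ hd₂
  obtain ⟨n₀, hn₀⟩ := eventually_atTop.1 (e₁.and e₂)
  refine ⟨n₀, fun n hn => ?_⟩
  obtain ⟨ha, hb⟩ := hn₀ n hn.le
  have key : ∀ s, |g (lam n s) * F ((u n).toFun (lam n s)) - g s * F (x.toFun s)| ≤ ε / 2 := by
    intro s
    have hs := ha s
    by_cases hsR : s ≤ R + 1
    · have k1 : |g (lam n s) - g s| ≤ ε / (4 * (C + 1)) := by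
        rw [abs_sub_comm]; exact (h₁ (hs.trans_le (min_le_left _ _))).le
      have k2 : |F ((u n).toFun (lam n s)) - F (x.toFun s)| ≤ ε / 4 := by
        rw [abs_sub_comm]; exact (h₂ (hb s hsR)).le
      have k3 : |F ((u n).toFun (lam n s))| ≤ C := by rw [abs_of_nonneg (hF0 _)]; exact hFC _
      have k4 : |g s| ≤ 1 := by rw [abs_of_nonneg (hg0 _)]; exact hg1 _
      have e : g (lam n s) * F ((u n).toFun (lam n s)) - g s * F (x.toFun s)
          = (g (lam n s) - g s) * F ((u n).toFun (lam n s))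
            + g s * (F ((u n).toFun (lam n s)) - F (x.toFun s)) := by ring
      rw [e]
      refine (abs_add_le _ _).trans ?_
      rw [abs_mul, abs_mul]
      have m1 : |g (lam n s) - g s| * |F ((u n).toFun (lam n s))| ≤ ε / (4 * (C + 1)) * C :=
        mul_le_mul k1 k3 (abs_nonneg _) (by positivity)
      have m2 : |g s| * |F ((u n).toFun (lam n s)) - F (x.toFun s)| ≤ 1 * (ε / 4) :=
        mul_le_mul k4 k2 (abs_nonneg _) zero_le_one
      have m3 : ε / (4 * (C + 1)) * C ≤ ε / 4 := by
        rw [div_mul_eq_mul_div, div_le_div_iff₀ (by positivity) (by norm_num)]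
        nlinarith
      linarith
    -- beyond `R + 1` both weights vanish, since the time change moves points by less than `1`
    · push Not at hsR
      have hs1 : dist s (lam n s) < 1 := hs.trans_le (min_le_right _ _)
      have hl : R ≤ lam n s := by
        rw [NNReal.dist_eq, abs_lt] at hs1
        have : ((R + 1 : ℝ≥0) : ℝ) < s := by exact_mod_cast hsR
        push_cast at this
        rw [← NNReal.coe_le_coe]
        linarith [hs1.2]
      rw [hgR _ hl, hgR s ((le_add_of_nonneg_right zero_le_one).trans hsR.le)]
      simpa using (half_pos hε).le
  have hsup : weightedSup g F (u n) = ⨆ s, g (lam n s) * F ((u n).toFun (lam n s)) :=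
    ((lam n).surjective.iSup_comp fun t => g t * F ((u n).toFun t)).symm
  have b1 := bddAbove_weightedSup hg1 hF0 hFC (u n)
  have b1' : BddAbove (Set.range fun s => g (lam n s) * F ((u n).toFun (lam n s))) :=
    b1.mono (by rintro _ ⟨s, rfl⟩; exact ⟨lam n s, rfl⟩)
  have b2 := bddAbove_weightedSup hg1 hF0 hFC x
  rw [Real.dist_eq, hsup]
  refine lt_of_le_of_lt (abs_sub_le_iff.2 ⟨?_, ?_⟩) (half_lt_self hε)
  · rw [sub_le_iff_le_add]
    refine ciSup_le fun s => ?_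
    have := le_ciSup b2 s
    have hk := (abs_sub_le_iff.1 (key s)).1
    simp only [weightedSup]
    linarith
  · rw [sub_le_iff_le_add]
    refine ciSup_le fun s => ?_
    have := le_ciSup b1' s
    have hk := (abs_sub_le_iff.1 (key s)).2
    linarith

end weightedSup

end SkorokhodSpace

/-- A trapezoidal weight: `1` within distance `δ` of `c`, and `0` beyond distance `2δ`. -/
noncomputable def trapezoid (c : ℝ≥0) (δ : ℝ) (t : ℝ≥0) : ℝ :=
  max 0 (min 1 (2 - dist t c / δ))

lemma trapezoid_nonneg (c : ℝ≥0) (δ : ℝ) (t : ℝ≥0) : 0 ≤ trapezoid c δ t := le_max_left _ _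

lemma trapezoid_le_one (c : ℝ≥0) (δ : ℝ) (t : ℝ≥0) : trapezoid c δ t ≤ 1 :=
  max_le zero_le_one (min_le_left _ _)

lemma trapezoid_eq_one {c : ℝ≥0} {δ : ℝ} (hδ : 0 < δ) {t : ℝ≥0} (ht : dist t c ≤ δ) :
    trapezoid c δ t = 1 := by
  have : dist t c / δ ≤ 1 := (div_le_one hδ).2 ht
  rw [trapezoid, min_eq_left (by linarith), max_eq_right zero_le_one]

lemma trapezoid_eq_zero {c : ℝ≥0} {δ : ℝ} (hδ : 0 < δ) {t : ℝ≥0} (ht : 2 * δ ≤ dist t c) :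
    trapezoid c δ t = 0 := by
  have : 2 ≤ dist t c / δ := (le_div_iff₀ hδ).2 ht
  exact max_eq_left ((min_le_right _ _).trans (by linarith))

lemma uniformContinuous_trapezoid (c : ℝ≥0) {δ : ℝ} (hδ : 0 < δ) :
    UniformContinuous (trapezoid c δ) := by
  refine (LipschitzWith.of_dist_le' (K := δ⁻¹) fun s t => ?_).uniformContinuous
  rw [Real.dist_eq]
  calc |trapezoid c δ s - trapezoid c δ t|
      ≤ |min 1 (2 - dist s c / δ) - min 1 (2 - dist t c / δ)| := by
        simpa [trapezoid, max_comm] using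
          abs_max_sub_max_le_abs (min 1 (2 - dist s c / δ)) (min 1 (2 - dist t c / δ)) 0
    _ ≤ |(2 - dist s c / δ) - (2 - dist t c / δ)| := by
        have := abs_min_sub_min_le_max 1 (2 - dist s c / δ) 1 (2 - dist t c / δ)
        simpa using this
    _ = δ⁻¹ * |dist s c - dist t c| := by
        have e : (2 - dist s c / δ) - (2 - dist t c / δ) = δ⁻¹ * -(dist s c - dist t c) := by
          field_simp
          ring
        rw [e, abs_mul, abs_neg, abs_of_pos (inv_pos.2 hδ)]
    _ ≤ δ⁻¹ * dist s t := by
        gcongr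
        exact abs_dist_sub_le s t c

namespace SkorokhodSpace

/-- As the trapezoidal weights shrink to a continuity point of the path, the weighted suprema
converge to the value there. -/
lemma tendsto_weightedSup_trapezoid {E : Type*} [PseudoMetricSpace E] {F : E → ℝ} {C : ℝ}
    (hF : Continuous F) (hF0 : ∀ x, 0 ≤ F x) (hFC : ∀ x, F x ≤ C) (x : SkorokhodSpace E)
    {c : ℝ≥0} (hx : ContinuousAt x.toFun c) :
    Tendsto (fun δ => weightedSup (trapezoid c δ) F x) (𝓝[>] 0) (𝓝 (F (x.toFun c))) := by
  rw [Metric.tendsto_nhds]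
  intro ε hε
  have hFx : ContinuousAt (fun t => F (x.toFun t)) c := hF.continuousAt.comp hx
  obtain ⟨d, hd, h⟩ := Metric.continuousAt_iff.1 hFx (ε / 2) (by positivity)
  filter_upwards [self_mem_nhdsWithin,
    mem_nhdsWithin_of_mem_nhds (Iio_mem_nhds (half_pos hd))] with δ hδ hδd
  have hδ : 0 < δ := hδ
  have hδd : δ < d / 2 := hδd
  have lower : F (x.toFun c) ≤ weightedSup (trapezoid c δ) F x :=
    le_weightedSup (trapezoid_le_one c δ) hF0 hFC x (trapezoid_eq_one hδ (by simpa using hδ.le))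
  have upper : weightedSup (trapezoid c δ) F x ≤ F (x.toFun c) + ε / 2 := by
    refine ciSup_le fun t => ?_
    by_cases ht : 2 * δ ≤ dist t c
    · rw [trapezoid_eq_zero hδ ht, zero_mul]
      linarith [hF0 (x.toFun c)]
    · have h1 := h (x := t) (by linarith)
      rw [Real.dist_eq, abs_lt] at h1
      have := mul_le_of_le_one_left (hF0 (x.toFun t)) (trapezoid_le_one c δ t)
      linarith [h1.2]
  rw [Real.dist_eq, abs_lt]
  constructor <;> linarith

end SkorokhodSpace

/-! ### Evaluating a weakly convergent sequence of processes at random times -/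

section RandomTime

variable {E : Type*} [SeminormedAddCommGroup E] [MeasurableSpace E] [BorelSpace E]
  {Ω Ω' ι : Type*} [MeasurableSpace Ω] {P : Measure Ω} [IsProbabilityMeasure P]
  [MeasurableSpace Ω'] {P' : Measure Ω'} [IsProbabilityMeasure P']
  {l : Filter ι} {X : ι → Ω → SkorokhodSpace E} {W : Ω' → SkorokhodSpace E}
  {V : ι → Ω → ℝ≥0} {c : ℝ≥0}

/-- One-sided version of convergence in distribution at random times: the expectation of
`F (X i (V i))` is at most that of a weighted supremum of `F` near `c`, up to the probability that
`V i` is not close to `c`. -/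
lemma eventually_integral_random_time_le (hXW : TendstoInDistribution X l W (fun _ => P) P')
    (hW : ∀ ω, ContinuousAt (W ω).toFun c) (hV : TendstoInMeasure P V l (fun _ => c))
    (hV_meas : ∀ i, Measurable (V i))
    (hXV : ∀ i, AEMeasurable (fun ω => (X i ω).toFun (V i ω)) P)
    {F : E → ℝ} (hF : UniformContinuous F) {C : ℝ} (hF0 : ∀ x, 0 ≤ F x) (hFC : ∀ x, F x ≤ C)
    {ε : ℝ} (hε : 0 < ε) :
    ∀ᶠ i in l, ∫ ω, F ((X i ω).toFun (V i ω)) ∂P ≤ ∫ ω, F ((W ω).toFun c) ∂P' + ε := by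
  have hcont : ∀ {δ : ℝ}, 0 < δ → Continuous (SkorokhodSpace.weightedSup (trapezoid c δ) F) := by
    intro δ hδ
    refine SkorokhodSpace.continuous_weightedSup (C := C) (R := c + Real.toNNReal (2 * δ))
      (uniformContinuous_trapezoid c hδ)
      (trapezoid_nonneg c δ) (trapezoid_le_one c δ) (fun t ht => ?_) hF hF0 hFC
    refine trapezoid_eq_zero hδ ?_
    rw [NNReal.dist_eq]
    have h := NNReal.coe_le_coe.2 ht
    rw [NNReal.coe_add, Real.coe_toNNReal _ (by positivity)] at h
    exact le_trans (by linarith) (le_abs_self _)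
  have hbd : ∀ δ x, ‖SkorokhodSpace.weightedSup (trapezoid c δ) F x‖ ≤ C := by
    intro δ x
    rw [Real.norm_of_nonneg (SkorokhodSpace.weightedSup_nonneg (trapezoid_nonneg c δ) hF0 x)]
    exact SkorokhodSpace.weightedSup_le (trapezoid_le_one c δ) hF0 hFC x
  -- choose the width `δ` of the weight
  have hlim : Tendsto (fun δ => ∫ ω, SkorokhodSpace.weightedSup (trapezoid c δ) F (W ω) ∂P')
      (𝓝[>] 0) (𝓝 (∫ ω, F ((W ω).toFun c) ∂P')) := by
    refine tendsto_integral_filter_of_dominated_convergence (fun _ => C) ?_ ?_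
      (integrable_const C) ?_
    · filter_upwards [self_mem_nhdsWithin] with δ hδ
      exact ((hcont hδ).measurable.comp_aemeasurable
        hXW.aemeasurable_limit).aestronglyMeasurable
    · exact Eventually.of_forall fun δ => Eventually.of_forall fun ω => hbd δ _
    · exact Eventually.of_forall fun ω =>
        SkorokhodSpace.tendsto_weightedSup_trapezoid hF.continuous hF0 hFC _ (hW ω)
  obtain ⟨δ, hδε, hδ⟩ := ((hlim.eventually (gt_mem_nhds
    (show _ < ∫ ω, F ((W ω).toFun c) ∂P' + ε / 3 by linarith))).and self_mem_nhdsWithin).exists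
  have hδ : 0 < δ := hδ
  let Ψ : BoundedContinuousFunction (SkorokhodSpace E) ℝ :=
    BoundedContinuousFunction.ofNormedAddCommGroup _ (hcont hδ) C (hbd δ)
  have hΨ : Tendsto (fun i => ∫ ω, Ψ (X i ω) ∂P) l (𝓝 (∫ ω, Ψ (W ω) ∂P')) := by
    have h := ProbabilityMeasure.tendsto_iff_forall_integral_tendsto.1 hXW.tendsto Ψ
    simp only [ProbabilityMeasure.coe_mk] at h
    have hΨm : StronglyMeasurable Ψ := (hcont hδ).measurable.stronglyMeasurable
    rw [integral_map hXW.aemeasurable_limit hΨm.aestronglyMeasurable] at h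
    exact h.congr fun i => integral_map (hXW.forall_aemeasurable i) hΨm.aestronglyMeasurable
  have hbad : Tendsto (fun i => C * P.real {ω | δ ≤ dist (V i ω) c}) l (𝓝 0) := by
    have h := tendstoInMeasure_iff_measureReal_dist.1 hV δ hδ
    simpa using h.const_mul C
  filter_upwards [hΨ.eventually (gt_mem_nhds (lt_add_of_pos_right _ (by positivity : 0 < ε / 3))),
    hbad.eventually (gt_mem_nhds (by positivity : 0 < ε / 3))] with i h1 h2
  have hmeas : MeasurableSet {ω | δ ≤ dist (V i ω) c} :=
    measurableSet_le measurable_const ((hV_meas i).dist measurable_const)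
  have hint : Integrable (fun ω => Ψ (X i ω)) P :=
    Integrable.of_bound ((hcont hδ).measurable.comp_aemeasurable
      (hXW.forall_aemeasurable i)).aestronglyMeasurable C
      (Eventually.of_forall fun ω => hbd δ _)
  have hind : Integrable ({ω | δ ≤ dist (V i ω) c}.indicator fun _ => C) P :=
    (integrable_const C).indicator hmeas
  have hFint : Integrable (fun ω => F ((X i ω).toFun (V i ω))) P :=
    Integrable.of_bound (hF.continuous.measurable.comp_aemeasurable (hXV i)).aestronglyMeasurable
      C (Eventually.of_forall fun ω => by
        rw [Real.norm_of_nonneg (hF0 _)]; exact hFC _)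
  calc ∫ ω, F ((X i ω).toFun (V i ω)) ∂P
      ≤ ∫ ω, (Ψ (X i ω) + {ω | δ ≤ dist (V i ω) c}.indicator (fun _ => C) ω) ∂P := by
        refine integral_mono hFint (hint.add hind) fun ω => ?_
        by_cases hω : δ ≤ dist (V i ω) c
        · have h0 : 0 ≤ Ψ (X i ω) :=
            SkorokhodSpace.weightedSup_nonneg (trapezoid_nonneg c δ) hF0 _
          have h3 : {ω | δ ≤ dist (V i ω) c}.indicator (fun _ => C) ω = C :=
            Set.indicator_of_mem (s := {ω | δ ≤ dist (V i ω) c}) hω _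
          simp only [h3]
          linarith [hFC ((X i ω).toFun (V i ω))]
        · have h3 : {ω | δ ≤ dist (V i ω) c}.indicator (fun _ => C) ω = 0 :=
            Set.indicator_of_notMem (s := {ω | δ ≤ dist (V i ω) c}) hω _
          simp only [h3, add_zero]
          exact SkorokhodSpace.le_weightedSup (trapezoid_le_one c δ) hF0 hFC _
            (trapezoid_eq_one hδ (not_le.1 hω).le)
    _ = ∫ ω, Ψ (X i ω) ∂P + C * P.real {ω | δ ≤ dist (V i ω) c} := by
        rw [integral_add hint hind, integral_indicator_const _ hmeas, smul_eq_mul, mul_comm]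
    _ ≤ ∫ ω, F ((W ω).toFun c) ∂P' + ε := by
        have h4 : ∫ ω, Ψ (W ω) ∂P' < ∫ ω, F ((W ω).toFun c) ∂P' + ε / 3 := hδε
        linarith

/-- If processes converge in distribution in the Skorokhod space to a process that is continuous
at `c`, and random times converge in probability to `c`, then the values of the processes at the
random times converge in distribution to the value of the limit at `c`. No independence is
needed. -/
theorem tendstoInDistribution_random_time [l.IsCountablyGenerated]
    (hXW : TendstoInDistribution X l W (fun _ => P) P')
    (hW : ∀ ω, ContinuousAt (W ω).toFun c) (hV : TendstoInMeasure P V l (fun _ => c))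
    (hV_meas : ∀ i, Measurable (V i))
    (hXV : ∀ i, AEMeasurable (fun ω => (X i ω).toFun (V i ω)) P)
    (hWc : AEMeasurable (fun ω => (W ω).toFun c) P') :
    TendstoInDistribution (fun i ω => (X i ω).toFun (V i ω)) l (fun ω => (W ω).toFun c)
      (fun _ => P) P' := by
  refine ⟨hXV, hWc, tendsto_iff_forall_lipschitz_integral_tendsto.2 ?_⟩
  rintro F ⟨C, hC⟩ ⟨L, hL⟩
  have hLc : Continuous F := hL.continuous
  have hC' : ∀ x, F x - F 0 ≤ C ∧ F 0 - F x ≤ C := fun x => by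
    have := hC x 0
    rw [Real.dist_eq] at this
    exact abs_sub_le_iff.1 this
  simp only [ProbabilityMeasure.coe_mk]
  rw [integral_map hWc hLc.aestronglyMeasurable]
  simp_rw [fun i => integral_map (hXV i) hLc.aestronglyMeasurable]
  have hi1 : ∀ i, Integrable (fun ω => F ((X i ω).toFun (V i ω))) P := fun i =>
    Integrable.of_bound (hLc.measurable.comp_aemeasurable (hXV i)).aestronglyMeasurable
      (C + ‖F 0‖) (Eventually.of_forall fun ω => by
        have := norm_sub_norm_le (F ((X i ω).toFun (V i ω))) (F 0)
        have h2 := hC ((X i ω).toFun (V i ω)) 0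
        rw [dist_eq_norm] at h2
        linarith)
  have hi2 : Integrable (fun ω => F ((W ω).toFun c)) P' :=
    Integrable.of_bound (hLc.measurable.comp_aemeasurable hWc).aestronglyMeasurable
      (C + ‖F 0‖) (Eventually.of_forall fun ω => by
        have := norm_sub_norm_le (F ((W ω).toFun c)) (F 0)
        have h2 := hC ((W ω).toFun c) 0
        rw [dist_eq_norm] at h2
        linarith)
  rw [Metric.tendsto_nhds]
  intro ε hε
  -- both inequalities come from the one-sided bound, for `F` and `-F` shifted to be nonnegative
  have up := eventually_integral_random_time_le hXW hW hV hV_meas hXV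
    (F := fun x => F x + (C - F 0)) (C := 2 * C)
    (hL.uniformContinuous.add uniformContinuous_const)
    (fun x => by linarith [(hC' x).2]) (fun x => by linarith [(hC' x).1]) (half_pos hε)
  have low := eventually_integral_random_time_le hXW hW hV hV_meas hXV
    (F := fun x => (C + F 0) - F x) (C := 2 * C)
    (uniformContinuous_const.sub hL.uniformContinuous)
    (fun x => by linarith [(hC' x).1]) (fun x => by linarith [(hC' x).2]) (half_pos hε)
  filter_upwards [up, low] with i h1 h2
  rw [integral_add (hi1 i) (integrable_const _), integral_add hi2 (integrable_const _)] at h1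
  rw [integral_sub (integrable_const _) (hi1 i), integral_sub (integrable_const _) hi2] at h2
  simp only [integral_const, probReal_univ, one_smul] at h1 h2
  rw [Real.dist_eq, abs_lt]
  constructor <;> linarith

end RandomTime

/-! ### The law of the limit -/

section GaussianLimit

variable {k : ℕ} {Ω : Type*} [MeasurableSpace Ω] {P : Measure Ω}
  {B : ℝ≥0 → Ω → EuclideanSpace ℝ (Fin k)}

lemma IsBrownianMotion.aemeasurable (hB : IsBrownianMotion B P) (t : ℝ≥0) :
    AEMeasurable (B t) P := by
  have h : AEMeasurable (fun ω => WithLp.toLp 2 fun i => B t ω i) P :=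
    (WithLp.measurable_toLp 2 (Fin k → ℝ)).comp_aemeasurable
      (aemeasurable_pi_lambda _ fun i => (hB.coord i).toIsPreBrownianReal.aemeasurable t)
  exact h

lemma IsBrownianMotion.charFun_map [IsProbabilityMeasure P] (hB : IsBrownianMotion B P) (t : ℝ≥0)
    (u : EuclideanSpace ℝ (Fin k)) :
    charFun (P.map (B t)) u = Complex.exp (-(t * ‖u‖ ^ 2 / 2 : ℝ)) := by
  have hco : ∀ i, AEMeasurable (fun ω => B t ω i) P := fun i =>
    (hB.coord i).toIsPreBrownianReal.aemeasurable t
  have hind : iIndepFun (fun (i : Fin k) ω => B t ω i) P :=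
    hB.indep.comp (fun _ f => f t) fun _ => measurable_pi_apply t
  have hpi := (iIndepFun_iff_map_fun_eq_pi_map hco).1 hind
  have hlaw : ∀ i, P.map (fun ω => B t ω i) = gaussianReal 0 t := fun i =>
    ((hB.coord i).toIsPreBrownianReal.hasLaw_eval t).map_eq
  simp_rw [hlaw] at hpi
  have hmap : P.map (B t) = (Measure.pi fun _ : Fin k => gaussianReal 0 t).map (WithLp.toLp 2) := by
    rw [← hpi, AEMeasurable.map_map_of_aemeasurable (WithLp.measurable_toLp 2 _).aemeasurable
      (aemeasurable_pi_lambda _ hco)]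
    rfl
  rw [hmap, charFun_pi]
  simp_rw [charFun_gaussianReal, ← Complex.exp_sum]
  congr 1
  rw [EuclideanSpace.real_norm_sq_eq]
  push_cast
  rw [Finset.mul_sum, Finset.sum_div, ← Finset.sum_neg_distrib]
  refine Finset.sum_congr rfl fun i _ => ?_
  simp

/-- The linear image `a • A⁻¹ S^{1/2} B_t` of a Brownian motion is centred Gaussian with covariance
`a² t • A⁻¹ S A⁻¹`. -/
lemma IsBrownianMotion.map_linear_eq_multivariateGaussian [IsProbabilityMeasure P]
    (hB : IsBrownianMotion B P) (t : ℝ≥0)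
    (a : ℝ) {S A : Matrix (Fin k) (Fin k) ℝ} (hS : S.PosDef) (hA : A.PosDef) :
    P.map (fun ω => a • Matrix.toEuclideanCLM (𝕜 := ℝ) A⁻¹
        (Matrix.toEuclideanCLM (𝕜 := ℝ) (CFC.sqrt S) (B t ω)))
      = multivariateGaussian 0 ((a ^ 2 * t) • (A⁻¹ * S * A⁻¹)) := by
  have hAi : (A⁻¹)ᴴ = A⁻¹ := hA.inv.isHermitian
  have hpsd : ((a ^ 2 * t) • (A⁻¹ * S * A⁻¹)).PosSemidef := by
    have h := hS.posSemidef.mul_mul_conjTranspose_same A⁻¹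
    rw [hAi] at h
    exact h.smul (by positivity)
  let M : EuclideanSpace ℝ (Fin k) →L[ℝ] EuclideanSpace ℝ (Fin k) :=
    a • (Matrix.toEuclideanCLM (𝕜 := ℝ) A⁻¹ ∘L Matrix.toEuclideanCLM (𝕜 := ℝ) (CFC.sqrt S))
  have hM : P.map (fun ω => a • Matrix.toEuclideanCLM (𝕜 := ℝ) A⁻¹
        (Matrix.toEuclideanCLM (𝕜 := ℝ) (CFC.sqrt S) (B t ω))) = (P.map (B t)).map M := by
    rw [AEMeasurable.map_map_of_aemeasurable M.continuous.aemeasurable (hB.aemeasurable t)]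
    rfl
  have := Measure.isProbabilityMeasure_map (hB.aemeasurable t)
  have := Measure.isProbabilityMeasure_map (μ := P.map (B t)) M.continuous.aemeasurable
  rw [hM]
  refine Measure.ext_of_charFun (funext fun u => ?_)
  have hsS : IsSelfAdjoint (Matrix.toEuclideanCLM (𝕜 := ℝ) (CFC.sqrt S)) :=
    (CFC.sqrt_nonneg S).isSelfAdjoint.map _
  have hsA : IsSelfAdjoint (Matrix.toEuclideanCLM (𝕜 := ℝ) A⁻¹) :=
    IsSelfAdjoint.map (show IsSelfAdjoint A⁻¹ from hAi) _
  have hadj : ∀ v, inner ℝ (M v) u = inner ℝ v (a • Matrix.toEuclideanCLM (𝕜 := ℝ) (CFC.sqrt S)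
      (Matrix.toEuclideanCLM (𝕜 := ℝ) A⁻¹ u)) := by
    intro v
    simp only [M, _root_.smul_apply, ContinuousLinearMap.comp_apply,
      real_inner_smul_left, real_inner_smul_right]
    rw [← ContinuousLinearMap.adjoint_inner_right, hsA.adjoint_eq,
      ← ContinuousLinearMap.adjoint_inner_right, hsS.adjoint_eq]
  have hnorm : ‖a • Matrix.toEuclideanCLM (𝕜 := ℝ) (CFC.sqrt S)
      (Matrix.toEuclideanCLM (𝕜 := ℝ) A⁻¹ u)‖ ^ 2
        = a ^ 2 * (u ⬝ᵥ (A⁻¹ * S * A⁻¹) *ᵥ u) := by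
    rw [norm_smul, mul_pow, Real.norm_eq_abs, sq_abs, ← real_inner_self_eq_norm_sq]
    congr 1
    rw [← ContinuousLinearMap.adjoint_inner_right, hsS.adjoint_eq,
      ← ContinuousLinearMap.adjoint_inner_right, hsA.adjoint_eq]
    simp only [← ContinuousLinearMap.comp_apply, ← ContinuousLinearMap.mul_def, ← map_mul]
    have hmul : A⁻¹ * (CFC.sqrt S * (CFC.sqrt S * A⁻¹)) = A⁻¹ * S * A⁻¹ := by
      rw [← mul_assoc (CFC.sqrt S), CFC.sqrt_mul_sqrt_self S hS.posSemidef.nonneg, mul_assoc]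
    rw [Matrix.inner_toEuclideanCLM, hmul]
  rw [charFun_multivariateGaussian hpsd]
  have hchar : charFun ((P.map (B t)).map M) u = charFun (P.map (B t))
      (a • Matrix.toEuclideanCLM (𝕜 := ℝ) (CFC.sqrt S)
        (Matrix.toEuclideanCLM (𝕜 := ℝ) A⁻¹ u)) := by
    rw [charFun_apply, charFun_apply, integral_map M.continuous.aemeasurable (by fun_prop)]
    simp_rw [hadj]
  rw [hchar, hB.charFun_map, hnorm]
  congr 1
  rw [inner_zero_right, Matrix.smul_mulVec, dotProduct_smul, smul_eq_mul]
  push_cast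
  ring

end GaussianLimit

/-! ### Functions whose gradient is close to a negative definite linear map -/

section NearlyQuadratic

variable {E : Type*} [NormedAddCommGroup E] [InnerProductSpace ℝ E]
  {A : E →L[ℝ] E} {s : Set E} {κ : ℝ} {c : ℝ≥0}

namespace ApproximatesLinearOn

lemma inner_sub_ge {g : E → E} (hg : ApproximatesLinearOn g A s c)
    (hA : ∀ v, κ * ‖v‖ ^ 2 ≤ inner ℝ v (A v)) {x y : E} (hx : x ∈ s) (hy : y ∈ s) :
    (κ - c) * ‖x - y‖ ^ 2 ≤ inner ℝ (x - y) (g x - g y) := by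
  have h1 := hg x hx y hy
  have h2 : -(c * ‖x - y‖ ^ 2) ≤ inner ℝ (x - y) (g x - g y - A (x - y)) := by
    have h3 := abs_real_inner_le_norm (x - y) (g x - g y - A (x - y))
    have h4 : ‖x - y‖ * ‖g x - g y - A (x - y)‖ ≤ ‖x - y‖ * (c * ‖x - y‖) := by gcongr
    nlinarith [neg_abs_le (inner ℝ (x - y) (g x - g y - A (x - y)))]
  have h5 := hA (x - y)
  rw [inner_sub_right] at h2
  linarith

lemma norm_sub_ge {g : E → E} (hg : ApproximatesLinearOn g A s c)
    (hA : ∀ v, κ * ‖v‖ ^ 2 ≤ inner ℝ v (A v)) {x y : E} (hx : x ∈ s) (hy : y ∈ s) :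
    (κ - c) * ‖x - y‖ ≤ ‖g x - g y‖ := by
  rcases (norm_nonneg (x - y)).eq_or_lt with h0 | h0
  · rw [← h0, mul_zero]
    exact norm_nonneg _
  · have h1 := hg.inner_sub_ge hA hx hy
    have h2 := real_inner_le_norm (x - y) (g x - g y)
    refine le_of_mul_le_mul_left ?_ h0
    calc ‖x - y‖ * ((κ - c) * ‖x - y‖) = (κ - c) * ‖x - y‖ ^ 2 := by ring
      _ ≤ _ := h1.trans h2

variable [CompleteSpace E] {f : E → ℝ} {a : ℝ}

/-- A function lies below its tangent planes if `-a` times its gradient is close to a positive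
definite linear map. -/
lemma le_add_inner_gradient
    (hg : ApproximatesLinearOn (fun x => -a • gradient f x) A s c)
    (hA : ∀ v, κ * ‖v‖ ^ 2 ≤ inner ℝ v (A v)) (hc : c ≤ κ) (ha : 0 < a) (hf : Differentiable ℝ f)
    (hs : Convex ℝ s) {x y : E} (hx : x ∈ s) (hy : y ∈ s) :
    f y ≤ f x + inner ℝ (gradient f x) (y - x) := by
  let p : ℝ → ℝ := fun t => f (x + t • (y - x))
  have hp : ∀ t, HasDerivAt p (inner ℝ (gradient f (x + t • (y - x))) (y - x)) t := by
    intro t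
    have h1 : HasDerivAt (fun t : ℝ => x + t • (y - x)) ((1 : ℝ) • (y - x)) t :=
      ((hasDerivAt_id t).smul_const (y - x)).const_add x
    have h2 := (hf (x + t • (y - x))).hasFDerivAt.comp_hasDerivAt t h1
    rw [one_smul] at h2
    rw [inner_gradient_left]
    exact h2
  obtain ⟨t, ht, hte⟩ := exists_hasDerivAt_eq_slope p _ (zero_lt_one' ℝ)
    (fun t _ => (hp t).continuousAt.continuousWithinAt) (fun t _ => hp t)
  have hxt : x + t • (y - x) ∈ s :=
    hs.add_smul_sub_mem hx hy ⟨ht.1.le, ht.2.le⟩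
  have hmono := hg.inner_sub_ge hA hxt hx
  have h0 : 0 ≤ (κ - c) * ‖x + t • (y - x) - x‖ ^ 2 := by
    have : 0 ≤ κ - c := by linarith
    positivity
  have h3 : inner ℝ (x + t • (y - x) - x)
      (-a • gradient f (x + t • (y - x)) - -a • gradient f x)
      = t * a * (inner ℝ (gradient f x) (y - x)
        - inner ℝ (gradient f (x + t • (y - x))) (y - x)) := by
    rw [add_sub_cancel_left, ← smul_sub, real_inner_smul_left, real_inner_smul_right,
      real_inner_comm, inner_sub_left]
    ring
  have h4 : inner ℝ (gradient f (x + t • (y - x))) (y - x) ≤ inner ℝ (gradient f x) (y - x) := by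
    have : 0 ≤ t * a * (inner ℝ (gradient f x) (y - x)
        - inner ℝ (gradient f (x + t • (y - x))) (y - x)) := by rw [← h3]; linarith
    linarith [nonneg_of_mul_nonneg_right this (mul_pos ht.1 ha)]
  have hp1 : p 1 = f y := by simp [p]
  have hp0 : p 0 = f x := by simp [p]
  rw [hp1, hp0] at hte
  simp only [sub_zero, div_one] at hte
  linarith

lemma concaveOn_of_gradient
    (hg : ApproximatesLinearOn (fun x => -a • gradient f x) A s c)
    (hA : ∀ v, κ * ‖v‖ ^ 2 ≤ inner ℝ v (A v)) (hc : c ≤ κ) (ha : 0 < a) (hf : Differentiable ℝ f)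
    (hs : Convex ℝ s) : ConcaveOn ℝ s f := by
  refine ⟨hs, fun x hx y hy u v hu hv huv => ?_⟩
  have hz : u • x + v • y ∈ s := hs hx hy hu hv huv
  have h1 := hg.le_add_inner_gradient hA hc ha hf hs hz hx
  have h2 := hg.le_add_inner_gradient hA hc ha hf hs hz hy
  set z := u • x + v • y with hzdef
  have h3 : u * inner ℝ (gradient f z) (x - z) + v * inner ℝ (gradient f z) (y - z) = 0 := by
    rw [← real_inner_smul_right, ← real_inner_smul_right, ← inner_add_right]
    have : u • (x - z) + v • (y - z) = 0 := by
      have : u • (x - z) + v • (y - z) = z - (u + v) • z := by rw [hzdef]; module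
      rw [this, huv, one_smul, sub_self]
    rw [this, inner_zero_right]
  simp only [smul_eq_mul]
  have h4 : (u + v) * f z = f z := by rw [huv, one_mul]
  nlinarith [mul_le_mul_of_nonneg_left h1 hu, mul_le_mul_of_nonneg_left h2 hv]

lemma isMaxOn_of_gradient_eq_zero
    (hg : ApproximatesLinearOn (fun x => -a • gradient f x) A s c)
    (hA : ∀ v, κ * ‖v‖ ^ 2 ≤ inner ℝ v (A v)) (hc : c ≤ κ) (ha : 0 < a) (hf : Differentiable ℝ f)
    (hs : Convex ℝ s) {x : E} (hx : x ∈ s) (hx0 : gradient f x = 0) : IsMaxOn f s x := by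
  intro y hy
  simpa [hx0] using hg.le_add_inner_gradient hA hc ha hf hs hx hy

/-- If the gradient at `b` is small, there is a critical point near `b`. -/
lemma exists_eq_zero {g : E → E} {b : E} {r : ℝ} (hg : ApproximatesLinearOn g A s c)
    (hA : ∀ v, κ * ‖v‖ ^ 2 ≤ inner ℝ v (A v)) (hκ : 0 < κ) {Ainv : E → E}
    (hAinv : ∀ v, A (Ainv v) = v) (hr : 0 ≤ r) (hrs : Metric.closedBall b r ⊆ s)
    (hb : ‖g b‖ ≤ (κ - c) * r) : ∃ x ∈ Metric.closedBall b r, g x = 0 := by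
  let R : A.NonlinearRightInverse :=
    { toFun := Ainv
      nnnorm := ⟨κ⁻¹, by positivity⟩
      bound' := fun v => by
        have h1 := hA (Ainv v)
        have h2 := real_inner_le_norm (Ainv v) (A (Ainv v))
        rw [hAinv] at h1 h2
        change ‖Ainv v‖ ≤ κ⁻¹ * ‖v‖
        rw [← div_eq_inv_mul, le_div_iff₀ hκ]
        rcases (norm_nonneg (Ainv v)).eq_or_lt with h0 | h0
        · rw [← h0, zero_mul]
          exact norm_nonneg _
        · refine le_of_mul_le_mul_left ?_ h0
          nlinarith
      right_inv' := hAinv }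
  have h := hg.surjOn_closedBall_of_nonlinearRightInverse R hr hrs
  have hmem : (0 : E) ∈ Metric.closedBall (g b) (((R.nnnorm : ℝ)⁻¹ - c) * r) := by
    have : (R.nnnorm : ℝ)⁻¹ = κ := inv_inv κ
    rw [this, Metric.mem_closedBall, dist_zero_left]
    exact hb
  obtain ⟨x, hx, hx0⟩ := h hmem
  exact ⟨x, hx, hx0⟩

end ApproximatesLinearOn

end NearlyQuadratic

lemma Matrix.PosDef.exists_coercive {k : ℕ} {A : Matrix (Fin k) (Fin k) ℝ} (hA : A.PosDef) :
    ∃ κ > 0, ∀ v, κ * ‖v‖ ^ 2 ≤ inner ℝ v (Matrix.toEuclideanCLM (𝕜 := ℝ) A v) := by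
  have hpos : ∀ v : EuclideanSpace ℝ (Fin k), v ≠ 0 →
      0 < inner ℝ v (Matrix.toEuclideanCLM (𝕜 := ℝ) A v) := by
    intro v hv
    rw [Matrix.inner_toEuclideanCLM]
    have := hA.dotProduct_mulVec_pos (x := v.ofLp) (by simpa using hv)
    simpa using this
  rcases (Metric.sphere (0 : EuclideanSpace ℝ (Fin k)) 1).eq_empty_or_nonempty with h | h
  · refine ⟨1, one_pos, fun v => ?_⟩
    by_cases hv : v = 0
    · simp [hv]
    · exact absurd (show ‖v‖⁻¹ • v ∈ Metric.sphere (0 : EuclideanSpace ℝ (Fin k)) 1 by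
        simp [norm_smul, hv]) (by simp [h])
  · obtain ⟨u, hu, hmin⟩ := (isCompact_sphere (0 : EuclideanSpace ℝ (Fin k)) 1).exists_isMinOn h
      (f := fun v => inner ℝ v (Matrix.toEuclideanCLM (𝕜 := ℝ) A v)) (by fun_prop)
    refine ⟨_, hpos u (ne_zero_of_mem_unit_sphere ⟨u, hu⟩), fun v => ?_⟩
    by_cases hv : v = 0
    · simp [hv]
    · have h1 := hmin (show ‖v‖⁻¹ • v ∈ Metric.sphere (0 : EuclideanSpace ℝ (Fin k)) 1 by
        simp [norm_smul, hv])
      simp only [Set.mem_ofPred_eq, map_smul, real_inner_smul_left, real_inner_smul_right] at h1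
      have hn : 0 < ‖v‖ := norm_pos_iff.2 hv
      calc _ ≤ (‖v‖⁻¹ * (‖v‖⁻¹ * inner ℝ v (Matrix.toEuclideanCLM (𝕜 := ℝ) A v))) * ‖v‖ ^ 2 := by
            gcongr
        _ = _ := by field_simp

lemma Matrix.PosDef.toEuclideanCLM_inv_apply {k : ℕ} {A : Matrix (Fin k) (Fin k) ℝ}
    (hA : A.PosDef) (v : EuclideanSpace ℝ (Fin k)) :
    Matrix.toEuclideanCLM (𝕜 := ℝ) A (Matrix.toEuclideanCLM (𝕜 := ℝ) A⁻¹ v) = v := by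
  rw [← ContinuousLinearMap.comp_apply, ← ContinuousLinearMap.mul_def, ← map_mul,
    Matrix.mul_nonsing_inv _ ((Matrix.isUnit_iff_isUnit_det _).1 hA.isUnit), map_one]
  rfl

/-! ### Bounds on the gradient from second and third partial derivatives -/

section Taylor

variable {k : ℕ} {f : EuclideanSpace ℝ (Fin k) → ℝ}

lemma EuclideanSpace.opNorm_le_sum_abs
    (L : EuclideanSpace ℝ (Fin k) →L[ℝ] EuclideanSpace ℝ (Fin k)) :
    ‖L‖ ≤ ∑ i, ∑ j, |L (EuclideanSpace.single i 1) j| := by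
  have hsum : ∀ v : EuclideanSpace ℝ (Fin k), v = ∑ i, v i • EuclideanSpace.single i (1 : ℝ) := by
    intro v
    simpa using ((EuclideanSpace.basisFun (Fin k) ℝ).sum_repr v).symm
  have hnorm : ∀ v : EuclideanSpace ℝ (Fin k), ‖v‖ ≤ ∑ i, |v i| := by
    intro v
    conv_lhs => rw [hsum v]
    exact (norm_sum_le _ _).trans (Finset.sum_le_sum fun i _ => by simp [norm_smul])
  refine L.opNorm_le_bound (by positivity) fun v => ?_
  conv_lhs => rw [hsum v, map_sum]
  rw [Finset.sum_mul]
  refine (norm_sum_le _ _).trans (Finset.sum_le_sum fun i _ => ?_)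
  rw [map_smul, norm_smul, mul_comm]
  gcongr
  · exact hnorm _
  · exact PiLp.norm_apply_le v i

/-- The derivative of the gradient is the second derivative, read as a linear map. -/
lemma exists_hasFDerivAt_gradient (hf : ContDiff ℝ 2 f) (x : EuclideanSpace ℝ (Fin k)) :
    ∃ D : EuclideanSpace ℝ (Fin k) →L[ℝ] EuclideanSpace ℝ (Fin k),
      HasFDerivAt (gradient f) D x ∧
      ∀ u v, inner ℝ (D u) v = iteratedFDeriv ℝ 2 f x ![u, v] := by
  -- the Riesz isomorphism, conjugate linear in Mathlib, as a linear map over `ℝ`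
  let riesz : (EuclideanSpace ℝ (Fin k) →L[ℝ] ℝ) →L[ℝ] EuclideanSpace ℝ (Fin k) :=
    LinearMap.toContinuousLinearMap
      { toFun := (InnerProductSpace.toDual ℝ (EuclideanSpace ℝ (Fin k))).symm
        map_add' := map_add _
        map_smul' := fun a L => by simp }
  have h : DifferentiableAt ℝ (fderiv ℝ f) x :=
    (hf.fderiv_right (m := 1) (by norm_num)).differentiable (by norm_num) x
  refine ⟨riesz ∘L fderiv ℝ (fderiv ℝ f) x, riesz.hasFDerivAt.comp x h.hasFDerivAt,
    fun u v => ?_⟩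
  rw [iteratedFDeriv_two_apply]
  exact InnerProductSpace.toDual_symm_apply

lemma continuous_gradient_of_contDiff (hf : ContDiff ℝ 2 f) : Continuous (gradient f) :=
  continuous_iff_continuousAt.2 fun x =>
    (exists_hasFDerivAt_gradient hf x).choose_spec.1.continuousAt

lemma abs_hessianMatrix_sub_le (hf : ContDiff ℝ 3 f) {s : Set (EuclideanSpace ℝ (Fin k))}
    (hs : Convex ℝ s) {τ : ℝ} (hτ : ∀ x ∈ s, ∀ h i j, |thirdPartial f x h i j| ≤ τ)
    {x y : EuclideanSpace ℝ (Fin k)} (hx : x ∈ s) (hy : y ∈ s) (i j : Fin k) :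
    |hessianMatrix f y i j - hessianMatrix f x i j| ≤ k * τ * ‖y - x‖ := by
  let m : Fin 2 → EuclideanSpace ℝ (Fin k) :=
    ![EuclideanSpace.single i 1, EuclideanSpace.single j 1]
  have hd : Differentiable ℝ (iteratedFDeriv ℝ 2 f) :=
    hf.differentiable_iteratedFDeriv (by norm_num)
  let ev : (EuclideanSpace ℝ (Fin k) [×2]→L[ℝ] ℝ) →L[ℝ] ℝ :=
    ContinuousMultilinearMap.apply ℝ _ ℝ m
  have hder : ∀ z, HasFDerivAt (fun z => hessianMatrix f z i j)
      (ev ∘L fderiv ℝ (iteratedFDeriv ℝ 2 f) z) z := fun z =>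
    ev.hasFDerivAt.comp z (hd z).hasFDerivAt
  refine hs.norm_image_sub_le_of_norm_hasFDerivWithin_le
    (fun z _ => (hder z).hasFDerivWithinAt) (fun z hz => ?_) hx hy
  have hτ0 : 0 ≤ τ := (abs_nonneg _).trans (hτ z hz i i i)
  refine ContinuousLinearMap.opNorm_le_bound _ (by positivity) fun v => ?_
  have hsum : v = ∑ h, v h • EuclideanSpace.single h (1 : ℝ) := by
    simpa using ((EuclideanSpace.basisFun (Fin k) ℝ).sum_repr v).symm
  have hthird : ∀ h, (ev ∘L fderiv ℝ (iteratedFDeriv ℝ 2 f) z) (EuclideanSpace.single h 1)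
      = thirdPartial f z h i j := by
    intro h
    rw [thirdPartial, iteratedFDeriv_succ_apply_left]
    rfl
  conv_lhs => rw [hsum, map_sum]
  refine (norm_sum_le _ _).trans ?_
  calc ∑ h, ‖(ev ∘L fderiv ℝ (iteratedFDeriv ℝ 2 f) z) (v h • EuclideanSpace.single h 1)‖
      ≤ ∑ _h : Fin k, τ * ‖v‖ := by
        refine Finset.sum_le_sum fun h _ => ?_
        rw [map_smul, hthird, norm_smul, mul_comm]
        exact mul_le_mul (hτ z hz h i j) (PiLp.norm_apply_le v h) (norm_nonneg _) hτ0
    _ = k * τ * ‖v‖ := by simp [mul_assoc]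

/-- If the Hessian at `x₀` is entrywise close to `A` and the third partial derivatives are bounded
on a ball around `x₀`, the gradient is close to the linear map `A` on this ball. -/
lemma approximatesLinearOn_gradient (hf : ContDiff ℝ 3 f) {A : Matrix (Fin k) (Fin k) ℝ}
    {x₀ : EuclideanSpace ℝ (Fin k)} {r τ η : ℝ} {c : ℝ≥0}
    (hA : A.IsHermitian) (hη : ∀ i j, |hessianMatrix f x₀ i j - A i j| ≤ η)
    (hτ : ∀ x ∈ Metric.ball x₀ r, ∀ h i j, |thirdPartial f x h i j| ≤ τ)
    (hτ0 : 0 ≤ τ) (hc : k * (k * (η + k * τ * r)) ≤ c) :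
    ApproximatesLinearOn (gradient f) (Matrix.toEuclideanCLM (𝕜 := ℝ) A) (Metric.ball x₀ r) c := by
  intro x hx y hy
  choose D hD hDin using
    exists_hasFDerivAt_gradient (f := f) (hf.of_le (by norm_num))
  refine (convex_ball x₀ r).norm_image_sub_le_of_norm_hasFDerivWithin_le'
    (fun z _ => (hD z).hasFDerivWithinAt) (fun z hz => ?_) hy hx
  refine (EuclideanSpace.opNorm_le_sum_abs _).trans (le_trans ?_ hc)
  have hr : 0 < r := Metric.pos_of_mem_ball hz
  have hx₀ : x₀ ∈ Metric.ball x₀ r := Metric.mem_ball_self hr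
  have hentry : ∀ i j, |((D z - Matrix.toEuclideanCLM (𝕜 := ℝ) A)
      (EuclideanSpace.single i 1)) j| ≤ η + k * τ * r := by
    intro i j
    have hcoord : ∀ v : EuclideanSpace ℝ (Fin k), v j = inner ℝ v (EuclideanSpace.single j 1) := by
      intro v
      simp [EuclideanSpace.inner_single_right]
    have e1 : (D z (EuclideanSpace.single i 1)) j = hessianMatrix f z i j := by
      rw [hcoord, hDin]
      rfl
    have e2 : (Matrix.toEuclideanCLM (𝕜 := ℝ) A (EuclideanSpace.single i 1)) j = A i j := by
      rw [← hA.apply i j]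
      simp [Matrix.ofLp_toEuclideanCLM]
    have e3 := abs_hessianMatrix_sub_le hf (convex_ball x₀ r) hτ hx₀ hz i j
    have e4 : k * τ * ‖z - x₀‖ ≤ k * τ * r := by
      gcongr
      rw [← dist_eq_norm]
      exact (Metric.mem_ball.1 hz).le
    rw [_root_.sub_apply, PiLp.sub_apply, e1, e2]
    have e5 := abs_sub_le (hessianMatrix f z i j) (hessianMatrix f x₀ i j) (A i j)
    linarith [hη i j]
  calc _ ≤ ∑ _i : Fin k, ∑ _j : Fin k, (η + k * τ * r) :=
        Finset.sum_le_sum fun i _ => Finset.sum_le_sum fun j _ => hentry i j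
    _ = _ := by
        simp only [Finset.sum_const, Finset.card_univ, Fintype.card_fin, nsmul_eq_mul]

lemma gradient_real_const_smul (a : ℝ) (x : EuclideanSpace ℝ (Fin k)) (hf : Differentiable ℝ f) :
    gradient (a • f) x = a • gradient f x := by
  rw [gradient, gradient, fderiv_const_smul (hf x), map_smul]

lemma hessianMatrix_const_smul (hf : ContDiff ℝ 3 f) (a : ℝ) (x : EuclideanSpace ℝ (Fin k)) :
    hessianMatrix (a • f) x = a • hessianMatrix f x := by
  ext i j
  rw [hessianMatrix, iteratedFDeriv_const_smul_apply (hf.of_le (by norm_num)).contDiffAt]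
  rfl

lemma thirdPartial_const_smul (hf : ContDiff ℝ 3 f) (a : ℝ) (x : EuclideanSpace ℝ (Fin k))
    (h i j : Fin k) : thirdPartial (a • f) x h i j = a * thirdPartial f x h i j := by
  rw [thirdPartial, iteratedFDeriv_const_smul_apply (hf.of_le (by norm_num)).contDiffAt]
  rfl

end Taylor

/-! ### Measurability -/

section Measurability

variable {Ω : Type*} [MeasurableSpace Ω]

lemma Measurable.comp_random_index {β : Type*} [MeasurableSpace β] {f : ℕ → Ω → β}
    (hf : ∀ m, Measurable (f m)) {N : Ω → ℕ} (hN : Measurable N) :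
    Measurable fun ω => f (N ω) ω :=
  (measurable_from_prod_countable_right (f := fun p : ℕ × Ω => f p.1 p.2) hf).comp
    (hN.prodMk measurable_id)

lemma measurable_gradient_param {k : ℕ} {f : Ω → EuclideanSpace ℝ (Fin k) → ℝ}
    (hf : ∀ x, Measurable fun ω => f ω x) (hd : ∀ ω, Differentiable ℝ (f ω))
    (x : EuclideanSpace ℝ (Fin k)) : Measurable fun ω => gradient (f ω) x := by
  have hcoord : ∀ i, Measurable fun ω => (gradient (f ω) x) i := by
    intro i
    have he : ∀ ω, (gradient (f ω) x) i = fderiv ℝ (f ω) x (EuclideanSpace.single i 1) := by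
      intro ω
      rw [← inner_gradient_left, EuclideanSpace.inner_single_right]
      simp
    simp_rw [he]
    refine measurable_of_tendsto_metrizable (f := fun (n : ℕ) ω =>
      (n : ℝ) • (f ω (x + (n : ℝ)⁻¹ • EuclideanSpace.single i 1) - f ω x))
      (fun n => ((hf _).sub (hf x)).const_mul (n : ℝ)) (tendsto_pi_nhds.2 fun ω => ?_)
    exact (hd ω x).hasFDerivAt.lim _ (tendsto_norm_atTop_atTop.comp tendsto_natCast_atTop_atTop)
  exact (WithLp.measurable_toLp 2 (Fin k → ℝ)).comp (measurable_pi_lambda _ hcoord)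

lemma measurableSet_approximatesLinearOn {E : Type*} [NormedAddCommGroup E] [NormedSpace ℝ E]
    [MeasurableSpace E] [BorelSpace E] [SecondCountableTopology E] {g : Ω → E → E}
    (hg : ∀ x, Measurable fun ω => g ω x) (hc : ∀ ω, Continuous (g ω)) (A : E →L[ℝ] E)
    (s : Set E) (c : ℝ≥0) : MeasurableSet {ω | ApproximatesLinearOn (g ω) A s c} := by
  -- by continuity it suffices to test the inequality on a countable dense subset of `s × s`
  obtain ⟨D, hDc, hD⟩ := TopologicalSpace.exists_countable_dense (s × s)
  have : {ω | ApproximatesLinearOn (g ω) A s c}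
      = ⋂ p ∈ D, {ω | ‖g ω p.1 - g ω p.2 - A (p.1 - p.2)‖ ≤ c * ‖(p.1 : E) - p.2‖} := by
    ext ω
    simp only [Set.mem_iInter, Set.mem_ofPred_eq]
    refine ⟨fun h p _ => h _ p.1.2 _ p.2.2, fun h x hx y hy => ?_⟩
    have hclosed : IsClosed {p : s × s |
        ‖g ω p.1 - g ω p.2 - A (p.1 - p.2)‖ ≤ c * ‖(p.1 : E) - p.2‖} := by
      have := hc ω
      exact isClosed_le (by fun_prop) (by fun_prop)
    have huniv := hclosed.closure_subset_iff.2 (show D ⊆ _ from fun p hp => h p hp)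
    rw [hD.closure_eq] at huniv
    exact huniv (Set.mem_univ (⟨x, hx⟩, ⟨y, hy⟩))
  rw [this]
  exact MeasurableSet.biInter hDc fun p _ =>
    measurableSet_le (((hg _).sub (hg _)).sub_const _).norm measurable_const

/-- The unique zero, on a compact set, of a nonnegative random continuous function is measurable. -/
lemma measurable_of_unique_zero {E : Type*} [MetricSpace E] [MeasurableSpace E] [BorelSpace E]
    [SecondCountableTopology E] {K : Set E} (hK : IsCompact K) {h : Ω → E → ℝ}
    (hm : ∀ x, Measurable fun ω => h ω x) (hc : ∀ ω, Continuous (h ω)) (h0 : ∀ ω x, 0 ≤ h ω x)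
    {z : Ω → E} (hzK : ∀ ω, z ω ∈ K) (hz : ∀ ω, h ω (z ω) = 0)
    (huniq : ∀ ω, ∀ x ∈ K, h ω x = 0 → x = z ω) : Measurable z := by
  refine measurable_of_isClosed fun F hF => ?_
  obtain ⟨D, hDc, hD⟩ := TopologicalSpace.exists_countable_dense ↥(F ∩ K)
  -- `z ω ∈ F` means that the infimum of `h ω` over `F ∩ K` vanishes
  have : z ⁻¹' F = ⋂ m : ℕ, ⋃ d ∈ D, {ω | h ω d < 1 / ((m : ℝ) + 1)} := by
    ext ω
    simp only [Set.mem_preimage, Set.mem_iInter, Set.mem_iUnion, Set.mem_ofPred_eq, exists_prop]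
    constructor
    · intro hω m
      have hopen : IsOpen {d : ↥(F ∩ K) | h ω d < 1 / ((m : ℝ) + 1)} := by
        have := hc ω
        exact isOpen_lt (by fun_prop) continuous_const
      obtain ⟨d, hd, hdD⟩ := hD.exists_mem_open hopen ⟨⟨z ω, hω, hzK ω⟩, by
        simp only [Set.mem_ofPred_eq, hz]; positivity⟩
      exact ⟨d, hd, hdD⟩
    · intro hω
      choose d _ hd using hω
      obtain ⟨w, hw, hmin⟩ := (hK.inter_left hF).exists_isMinOn ⟨d 0, (d 0).2⟩
        (hc ω).continuousOn
      have hw0 : h ω w = 0 := by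
        refine le_antisymm ?_ (h0 ω w)
        refine ge_of_tendsto' (tendsto_one_div_add_atTop_nhds_zero_nat (𝕜 := ℝ)) fun m => ?_
        exact (hmin (d m).2).trans (hd m).le
      rw [← huniq ω w hw.2 hw0]
      exact hw.1
  rw [this]
  exact MeasurableSet.iInter fun m => MeasurableSet.biUnion hDc fun d _ =>
    measurableSet_lt (hm d) measurable_const

/-- Measurable selection of a random zero that is unique in a compact set `K`. -/
lemma exists_measurable_zero {E : Type*} [NormedAddCommGroup E] [MeasurableSpace E] [BorelSpace E]
    [SecondCountableTopology E] {K : Set E} (hK : IsCompact K) {x₀ : E} (hx₀ : x₀ ∈ K)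
    {F : Ω → E → E} (hm : ∀ x, Measurable fun ω => F ω x) (hc : ∀ ω, Continuous (F ω))
    {G : Set Ω} (hG : MeasurableSet G) (hex : ∀ ω ∈ G, ∃ x ∈ K, F ω x = 0)
    (huniq : ∀ ω ∈ G, ∀ x ∈ K, ∀ y ∈ K, F ω x = 0 → F ω y = 0 → x = y) :
    ∃ z : Ω → E, Measurable z ∧ ∀ ω ∈ G, z ω ∈ K ∧ F ω (z ω) = 0 := by
  classical
  choose! z hzK hz using hex
  -- off the event `G`, the selected point is `x₀`
  refine ⟨fun ω => if ω ∈ G then z ω else x₀, ?_, fun ω hω => ?_⟩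
  · refine measurable_of_unique_zero hK (h := fun ω x => if ω ∈ G then ‖F ω x‖ else ‖x - x₀‖)
      (fun x => Measurable.ite hG (hm x).norm measurable_const) (fun ω => ?_) (fun ω x => ?_)
      (fun ω => ?_) (fun ω => ?_) (fun ω x hx h0 => ?_)
    all_goals by_cases hω : ω ∈ G
    · simpa only [if_pos hω] using (hc ω).norm
    · simp only [if_neg hω]
      fun_prop
    · simp only [if_pos hω]
      positivity
    · simp only [if_neg hω]
      positivity
    · simpa only [if_pos hω] using hzK ω hω
    · simpa only [if_neg hω] using hx₀
    · simp only [if_pos hω, hz ω hω, norm_zero]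
    · simp only [if_neg hω, sub_self, norm_zero]
    · rw [if_pos hω] at h0 ⊢
      exact huniq ω hω x hx _ (hzK ω hω) (norm_eq_zero.1 h0) (hz ω hω)
    · rw [if_neg hω] at h0 ⊢
      exact sub_eq_zero.1 (norm_eq_zero.1 h0)
  · simp only [hω, if_true]
    exact ⟨hzK ω hω, hz ω hω⟩

end Measurability

/-! ### Convergence in probability -/

section InProbability

variable {Ω ι : Type*} [MeasurableSpace Ω] {P : Measure Ω} {l : Filter ι}

/-- Measurable events that almost surely occur eventually have probability tending to one. -/
lemma tendsto_measure_compl_of_ae_eventually_mem [IsFiniteMeasure P] [l.IsCountablyGenerated]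
    {s : ι → Set Ω} (hs : ∀ i, MeasurableSet (s i)) (h : ∀ᵐ ω ∂P, ∀ᶠ i in l, ω ∈ s i) :
    Tendsto (fun i => P (s i)ᶜ) l (𝓝 0) := by
  have := tendsto_measure_of_ae_tendsto_indicator (A := ∅) (As := fun i => (s i)ᶜ) (μ := P) l
    MeasurableSet.empty (fun i => (hs i).compl) MeasurableSet.univ (measure_ne_top P _)
    (Eventually.of_forall fun _ => Set.subset_univ _)
    (h.mono fun ω hω => hω.mono fun i hi => by simpa using hi)
  simpa using this

lemma tendstoInMeasure_of_ae_tendsto {E : Type*} [PseudoMetricSpace E] [MeasurableSpace E]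
    [BorelSpace E] [SecondCountableTopology E] [IsFiniteMeasure P] [l.IsCountablyGenerated]
    {f : ι → Ω → E} {a : E} (hf : ∀ i, Measurable (f i))
    (h : ∀ᵐ ω ∂P, Tendsto (fun i => f i ω) l (𝓝 a)) :
    TendstoInMeasure P f l (fun _ => a) := by
  rw [tendstoInMeasure_iff_dist]
  intro ε hε
  have := tendsto_measure_compl_of_ae_eventually_mem (P := P) (l := l)
    (s := fun i => {ω | dist (f i ω) a < ε})
    (fun i => measurableSet_lt ((hf i).dist measurable_const) measurable_const)
    (h.mono fun ω hω => hω.eventually (Metric.ball_mem_nhds a hε))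
  simpa [Set.compl_ofPred] using this

/-- A sequence that is negligible with respect to a sequence converging in distribution tends to
zero in probability, since the latter is tight. -/
lemma tendstoInMeasure_zero_of_negligible {E F Ω' : Type*}
    [NormedAddCommGroup E] [MeasurableSpace E] [BorelSpace E] [NormedAddCommGroup F]
    [MeasurableSpace Ω'] {P' : Measure Ω'} [IsProbabilityMeasure P'] [IsProbabilityMeasure P]
    {Y : ι → Ω → E} {Z : Ω' → E} {W : ι → Ω → F}
    (hY : TendstoInDistribution Y l Z (fun _ => P) P')
    (hW : ∀ ε > 0, Tendsto (fun i => P {ω | ε * ‖Y i ω‖ < ‖W i ω‖}) l (𝓝 0)) :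
    TendstoInMeasure P W l (fun _ => 0) := by
  rw [tendstoInMeasure_iff_norm]
  intro δ hδ
  simp only [sub_zero]
  refine ENNReal.tendsto_nhds_zero.2 fun η hη => ?_
  -- the limit law gives small mass to the complement of a large ball
  have htail : Tendsto (fun R : ℕ => P'.map Z {x : E | (R : ℝ) ≤ ‖x‖}) atTop (𝓝 0) := by
    have := Measure.isProbabilityMeasure_map hY.aemeasurable_limit
    have h := tendsto_measure_iInter_atTop (μ := P'.map Z)
      (s := fun R : ℕ => {x : E | (R : ℝ) ≤ ‖x‖})
      (fun R => (measurableSet_le measurable_const measurable_norm).nullMeasurableSet)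
      (fun R R' hR x (hx : (R' : ℝ) ≤ ‖x‖) => le_trans (Nat.cast_le.2 hR) hx)
      ⟨0, measure_ne_top _ _⟩
    have he : ⋂ R : ℕ, {x : E | (R : ℝ) ≤ ‖x‖} = ∅ := by
      refine Set.eq_empty_of_forall_notMem fun x hx => ?_
      obtain ⟨R, hR⟩ := exists_nat_gt ‖x‖
      exact absurd (Set.mem_iInter.1 hx R) (not_le.2 hR)
    rwa [he, measure_empty] at h
  obtain ⟨R, hR, hR1⟩ := ((htail.eventually (gt_mem_nhds (ENNReal.half_pos hη.ne'))).and
    (eventually_ge_atTop 1)).exists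
  have hR0 : (0 : ℝ) < R := by exact_mod_cast hR1
  have hclosed : IsClosed {x : E | (R : ℝ) ≤ ‖x‖} := isClosed_le continuous_const continuous_norm
  have hlimsup := ProbabilityMeasure.limsup_measure_closed_le_of_tendsto hY.tendsto hclosed
  simp only [ProbabilityMeasure.coe_mk] at hlimsup
  have hev := eventually_lt_of_limsup_lt (hlimsup.trans_lt hR)
  filter_upwards [hev, ENNReal.tendsto_nhds_zero.1 (hW (δ / (2 * R)) (by positivity)) (η / 2)
    (ENNReal.half_pos hη.ne')] with i h1 h2
  rw [Measure.map_apply_of_aemeasurable (hY.forall_aemeasurable i) hclosed.measurableSet] at h1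
  calc P {ω | δ ≤ ‖W i ω‖}
      ≤ P (Y i ⁻¹' {x : E | (R : ℝ) ≤ ‖x‖} ∪ {ω | δ / (2 * R) * ‖Y i ω‖ < ‖W i ω‖}) := by
        refine measure_mono fun ω (hω : δ ≤ ‖W i ω‖) => ?_
        by_contra hcon
        simp only [Set.mem_union, Set.mem_preimage, Set.mem_ofPred_eq, not_or, not_le,
          not_lt] at hcon
        have h3 : δ / (2 * R) * ‖Y i ω‖ ≤ δ / (2 * R) * R := by
          gcongr
          exact hcon.1.le
        have h4 : δ / (2 * R) * R = δ / 2 := by field_simp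
        linarith [hcon.2]
    _ ≤ η / 2 + η / 2 := (measure_union_le _ _).trans (add_le_add h1.le h2)
    _ = η := ENNReal.add_halves η

end InProbability

/-! ### The score at the random time -/

section Score

variable {Ω Ω' : Type*} [MeasurableSpace Ω] {P : Measure Ω} [IsProbabilityMeasure P]
  [MeasurableSpace Ω'] {P' : Measure Ω'} [IsProbabilityMeasure P']

lemma tendsto_floor_div_toReal :
    Tendsto (fun T : ℝ≥0 => (⌊(T : ℝ)⌋₊ : ℝ) / (T : ℝ)) atTop (𝓝 1) :=
  (tendsto_nat_floor_div_atTop (R := ℝ)).comp (NNReal.tendsto_coe_atTop.2 tendsto_id)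

lemma tendsto_atTop_of_tendsto_div {N : ℝ≥0 → ℕ} {c : ℝ} (hc : 0 < c)
    (h : Tendsto (fun T : ℝ≥0 => (N T : ℝ) / (T : ℝ)) atTop (𝓝 c)) : Tendsto N atTop atTop := by
  rw [← tendsto_natCast_atTop_iff (R := ℝ)]
  have h1 : Tendsto (fun T : ℝ≥0 => (T : ℝ)) atTop atTop := NNReal.tendsto_coe_atTop.2 tendsto_id
  refine (h.pos_mul_atTop hc h1).congr' ?_
  filter_upwards [eventually_gt_atTop 0] with T hT
  have : (T : ℝ) ≠ 0 := by exact_mod_cast hT.ne'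
  field_simp

/-- If the rescaled step processes of `S` converge in distribution to `W`, then the normalized
value of `S` at the random index `N T`, with `N T / T → c`, converges in distribution. -/
lemma tendstoInDistribution_random_index {E : Type*} [NormedAddCommGroup E] [NormedSpace ℝ E]
    [MeasurableSpace E] [BorelSpace E] [SecondCountableTopology E] {S : ℕ → Ω → E}
    (hS : ∀ m, Measurable (S m)) {W : Ω' → SkorokhodSpace E} {c : ℝ≥0} (hc : 0 < c)
    (hSW : TendstoInDistribution
      (fun (m : ℕ) ω => SkorokhodSpace.step m fun j => (√(m : ℝ))⁻¹ • S j ω) atTop W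
      (fun _ => P) P')
    (hW : ∀ ω, ContinuousAt (W ω).toFun c) (hWc : AEMeasurable (fun ω => (W ω).toFun c) P')
    {N : ℝ≥0 → Ω → ℕ} (hN : ∀ T, Measurable (N T))
    (hNc : ∀ᵐ ω ∂P, Tendsto (fun T : ℝ≥0 => (N T ω : ℝ) / (T : ℝ)) atTop (𝓝 c)) :
    TendstoInDistribution (fun (T : ℝ≥0) ω => (√(T : ℝ) / N T ω) • S (N T ω) ω) atTop
      (fun ω => (c : ℝ)⁻¹ • (W ω).toFun c) (fun _ => P) P' := by
  let m : ℝ≥0 → ℕ := fun T => ⌊(T : ℝ)⌋₊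
  have hcoe : Tendsto (fun T : ℝ≥0 => (T : ℝ)) atTop atTop := NNReal.tendsto_coe_atTop.2 tendsto_id
  have hm : Tendsto m atTop atTop := tendsto_nat_floor_atTop.comp hcoe
  have hNr : ∀ T, Measurable fun ω => (N T ω : ℝ) := fun T => measurable_from_top.comp (hN T)
  have hSN : ∀ T, Measurable fun ω => S (N T ω) ω := fun T =>
    Measurable.comp_random_index hS (hN T)
  let V : ℝ≥0 → Ω → ℝ≥0 := fun T ω => (N T ω : ℝ≥0) / (m T : ℝ≥0)
  have hVm : ∀ T, Measurable (V T) := fun T =>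
    (measurable_from_top (f := fun j : ℕ => (j : ℝ≥0) / (m T : ℝ≥0))).comp (hN T)
  have hV : TendstoInMeasure P V atTop (fun _ => c) := by
    refine tendstoInMeasure_of_ae_tendsto hVm (hNc.mono fun ω hω => ?_)
    rw [← NNReal.tendsto_coe]
    have h := hω.mul (tendsto_floor_div_toReal.inv₀ one_ne_zero)
    rw [inv_one, mul_one] at h
    refine h.congr' ?_
    filter_upwards [eventually_ge_atTop 1] with T hT
    have hT0 : (T : ℝ) ≠ 0 := by
      have : (1 : ℝ) ≤ T := by exact_mod_cast hT
      positivity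
    simp only [V, m, NNReal.coe_div, NNReal.coe_natCast]
    rw [inv_div, div_mul_div_cancel₀ hT0]
  have hstep : ∀ T ω, (SkorokhodSpace.step (m T) fun j => (√(m T : ℝ))⁻¹ • S j ω).toFun (V T ω)
      = (√(m T : ℝ))⁻¹ • S (N T ω) ω := by
    intro T ω
    rcases Nat.eq_zero_or_pos (m T) with h0 | h0
    · simp [SkorokhodSpace.step, h0]
    · have h1 : (m T : ℝ≥0) ≠ 0 := by exact_mod_cast h0.ne'
      simp only [SkorokhodSpace.step, V]
      rw [mul_div_cancel₀ _ h1, Nat.floor_natCast]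
  have hmSW : TendstoInDistribution
      (fun T ω => SkorokhodSpace.step (m T) fun j => (√(m T : ℝ))⁻¹ • S j ω) atTop W
      (fun _ => P) P' :=
    ⟨fun T => hSW.forall_aemeasurable _, hSW.aemeasurable_limit, hSW.tendsto.comp hm⟩
  have h1 := tendstoInDistribution_random_time hmSW hW hV hVm
    (fun T => by
      simp_rw [hstep]
      exact ((hSN T).const_smul _).aemeasurable) hWc
  simp_rw [hstep] at h1
  let ρ : ℝ≥0 → Ω → ℝ := fun T ω => √((m T : ℝ) / (T : ℝ)) * ((N T ω : ℝ) / (T : ℝ))⁻¹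
  have hρm : ∀ T, Measurable (ρ T) := fun T => (((hNr T).div_const _).inv).const_mul _
  have hc0 : (c : ℝ) ≠ 0 := by exact_mod_cast hc.ne'
  have hρ : TendstoInMeasure P ρ atTop (fun _ => (c : ℝ)⁻¹) := by
    refine tendstoInMeasure_of_ae_tendsto hρm (hNc.mono fun ω hω => ?_)
    have h := tendsto_floor_div_toReal.sqrt.mul (hω.inv₀ hc0)
    rwa [Real.sqrt_one, one_mul] at h
  have h2 := h1.continuous_comp_prodMk_of_tendstoInMeasure_const
    (g := fun p : E × ℝ => p.2 • p.1) (by fun_prop) hρ fun T => (hρm T).aemeasurable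
  refine ⟨fun T => ((measurable_const.div (hNr T)).smul (hSN T)).aemeasurable,
    h2.aemeasurable_limit, h2.tendsto.congr' ?_⟩
  filter_upwards [eventually_ge_atTop 1] with T hT
  refine Subtype.ext ?_
  simp only
  congr 1
  funext ω
  have hT1 : (1 : ℝ) ≤ T := by exact_mod_cast hT
  have hT0 : (0 : ℝ) < T := by positivity
  have hm0 : (0 : ℝ) < m T := by exact_mod_cast Nat.floor_pos.2 hT1
  have hsT : 0 < √(T : ℝ) := Real.sqrt_pos.2 hT0
  have hsm : 0 < √(m T : ℝ) := Real.sqrt_pos.2 hm0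
  rw [smul_smul]
  congr 1
  simp only [ρ]
  rw [Real.sqrt_div hm0.le, inv_div]
  conv_lhs => rw [← Real.mul_self_sqrt hT0.le, Real.sqrt_mul_self hsT.le]
  field_simp

end Score

/-! ### Uniform approximation of the rescaled gradients -/

section Approximation

variable {k : ℕ}

/-- `approximatesLinearOn_gradient` for a scalar multiple of a function. -/
lemma approximatesLinearOn_smul_gradient {f : EuclideanSpace ℝ (Fin k) → ℝ} (hf : ContDiff ℝ 3 f)
    (a : ℝ) {A : Matrix (Fin k) (Fin k) ℝ}
    {x₀ : EuclideanSpace ℝ (Fin k)} {r τ η : ℝ} {c : ℝ≥0}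
    (hA : A.IsHermitian) (hη : ∀ i j, |(a • hessianMatrix f x₀) i j - A i j| ≤ η)
    (hτ : ∀ x ∈ Metric.ball x₀ r, ∀ h i j, |a * thirdPartial f x h i j| ≤ τ)
    (hτ0 : 0 ≤ τ) (hc : k * (k * (η + k * τ * r)) ≤ c) :
    ApproximatesLinearOn (fun x => a • gradient f x) (Matrix.toEuclideanCLM (𝕜 := ℝ) A)
      (Metric.ball x₀ r) c := by
  have hfun : (fun x => a • gradient f x) = gradient (a • f) :=
    funext fun x => (gradient_real_const_smul a x (hf.differentiable (by norm_num))).symm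
  have hf' : ContDiff ℝ 3 (a • f) := contDiff_const.smul hf
  rw [hfun]
  refine approximatesLinearOn_gradient hf' hA (fun i j => ?_) (fun x hx h i j => ?_) hτ0 hc
  · rw [hessianMatrix_const_smul hf]
    exact hη i j
  · rw [thirdPartial_const_smul hf]
    exact hτ x hx h i j

/-- Along a sequence of criterion functions whose rescaled Hessians converge at `x₀` and whose
rescaled third derivatives stay bounded, the rescaled gradients are eventually close to a fixed
linear map on a fixed ball; the radius depends only on the limits `A` and `t` and on the precision
`ε`, not on the sequence. -/
lemma exists_ball_forall_eventually_approximatesLinearOn {A : Matrix (Fin k) (Fin k) ℝ}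
    (hA : A.IsHermitian) {x₀ : EuclideanSpace ℝ (Fin k)} {N : Set (EuclideanSpace ℝ (Fin k))}
    (hN : N ∈ 𝓝 x₀) {t : ℝ} (ht : 0 < t) {ε : ℝ≥0} (hε : 0 < ε) :
    ∃ r > 0, Metric.ball x₀ r ⊆ N ∧
      ∀ (q : ℕ → EuclideanSpace ℝ (Fin k) → ℝ) (τ : ℕ → ℝ), (∀ m, ContDiff ℝ 3 (q m)) →
        Tendsto (fun m : ℕ => (-(m : ℝ)⁻¹) • hessianMatrix (q m) x₀) atTop (𝓝 A) →
        (∀ m : ℕ, 1 ≤ m → ∀ x ∈ N, ∀ h i j, |(m : ℝ)⁻¹ * thirdPartial (q m) x h i j| ≤ τ m) →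
        Tendsto τ atTop (𝓝 t) →
        ∀ᶠ m : ℕ in atTop, ApproximatesLinearOn (fun x => -(m : ℝ)⁻¹ • gradient (q m) x)
          (Matrix.toEuclideanCLM (𝕜 := ℝ) A) (Metric.ball x₀ r) ε := by
  obtain ⟨r₀, hr₀, hr₀N⟩ := Metric.mem_nhds_iff.1 hN
  have hε' : (0 : ℝ) < ε := by exact_mod_cast hε
  set M : ℝ := k * (k * (k * (t + 1))) with hM
  have hM0 : 0 ≤ M := by positivity
  set r : ℝ := min r₀ (ε / (2 * (M + 1))) with hr
  set η : ℝ := ε / (2 * (k * k + 1)) with hη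
  have hη0 : 0 < η := by positivity
  refine ⟨r, lt_min hr₀ (by positivity), (Metric.ball_subset_ball (min_le_left _ _)).trans hr₀N,
    fun q τ hq hH hT hτ => ?_⟩
  have hent : ∀ᶠ m : ℕ in atTop, ∀ i j,
      |((-(m : ℝ)⁻¹) • hessianMatrix (q m) x₀) i j - A i j| < η := by
    rw [eventually_all]
    intro i
    rw [eventually_all]
    intro j
    have h := tendsto_pi_nhds.1 (tendsto_pi_nhds.1 hH i) j
    exact h.eventually (Metric.ball_mem_nhds _ hη0)
  filter_upwards [hent, hτ.eventually (gt_mem_nhds (lt_add_one t)), eventually_ge_atTop 1]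
    with m h1 h2 h3
  refine approximatesLinearOn_smul_gradient (hq m) _ hA (fun i j => (h1 i j).le)
    (τ := t + 1) (fun x hx h i j => ?_) (by positivity) ?_
  · rw [neg_mul, abs_neg]
    exact (hT m h3 x (hr₀N (Metric.ball_subset_ball (min_le_left _ _) hx)) h i j).trans h2.le
  · have e1 : (k : ℝ) * k * η ≤ ε / 2 := by
      rw [hη, mul_div_assoc', div_le_div_iff₀ (by positivity) (by norm_num)]
      nlinarith
    have e2 : M * r ≤ ε / 2 := by
      have : M * r ≤ M * (ε / (2 * (M + 1))) := by gcongr; exact min_le_right _ _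
      refine this.trans ?_
      rw [mul_div_assoc', div_le_div_iff₀ (by positivity) (by norm_num)]
      nlinarith
    have e3 : (k : ℝ) * (k * (η + k * (t + 1) * r)) = k * k * η + M * r := by rw [hM]; ring
    linarith

end Approximation

/-! ### Asymptotics of the maximizer -/

theorem lemma1 {k : ℕ}
    {Ω : Type*} [MeasurableSpace Ω] (P : Measure Ω) [IsProbabilityMeasure P]
    -- the criterion functions `Q n ω φ`
    (Q : ℕ → Ω → EuclideanSpace ℝ (Fin k) → ℝ)
    (hQ_meas : ∀ n φ, Measurable fun ω => Q n ω φ)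
    (hQ_diff : ∀ n ω, ContDiff ℝ 3 (Q n ω))
    (Φ : Set (EuclideanSpace ℝ (Fin k))) (φ₀ : EuclideanSpace ℝ (Fin k))
    (hφ₀ : φ₀ ∈ interior Φ)
    (ΩS ΩI : Matrix (Fin k) (Fin k) ℝ) (hΩS : ΩS.PosDef) (hΩI : ΩI.PosDef)
    -- a standard Brownian motion, possibly on another probability space
    {Ω' : Type*} [MeasurableSpace Ω'] (P' : Measure Ω') [IsProbabilityMeasure P']
    (B : ℝ≥0 → Ω' → EuclideanSpace ℝ (Fin k)) (hB : IsBrownianMotion B P')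
    -- (C.1) functional central limit theorem for the score
    (hC1 : TendstoInDistribution (fun (n : ℕ) ω => scorePath (fun m => Q m ω) φ₀ n) atTop
      (brownianLimitPath hB ΩS) (fun _ => P) P')
    -- (C.2) the Hessian
    (hC2 : ∀ᵐ ω ∂P, Tendsto (fun n : ℕ => (-(n : ℝ)⁻¹) • hessianMatrix (Q n ω) φ₀) atTop (𝓝 ΩI))
    -- (C.3) third derivatives
    (N : Set (EuclideanSpace ℝ (Fin k))) (hN : N ∈ 𝓝 φ₀)
    (τ : ℕ → Ω → ℝ) (hτ_meas : ∀ n, Measurable (τ n)) (τ_lim : ℝ) (hτ_pos : 0 < τ_lim)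
    (hC3_bound : ∀ᵐ ω ∂P, ∀ n : ℕ, 1 ≤ n → ∀ φ ∈ N, ∀ h i j,
      |(n : ℝ)⁻¹ * thirdPartial (Q n ω) φ h i j| ≤ τ n ω)
    (hC3_lim : ∀ᵐ ω ∂P, Tendsto (fun n => τ n ω) atTop (𝓝 τ_lim))
    -- (C.4) the counting process
    (n : ℝ≥0 → Ω → ℕ) (hn : IsCountingProcess n) (c : ℝ) (hc : 0 < c)
    (hC4 : ∀ᵐ ω ∂P, Tendsto (fun T : ℝ≥0 => (n T ω : ℝ) / (T : ℝ)) atTop (𝓝 c)) :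
    ∃ U : Set (EuclideanSpace ℝ (Fin k)), IsOpen U ∧ φ₀ ∈ U ∧ U ⊆ N ∧ U ⊆ Φ ∧
      ∃ φhat : ℝ≥0 → Ω → EuclideanSpace ℝ (Fin k),
        (∀ T, Measurable (φhat T)) ∧
        -- (i) the event below fails with probability tending to zero
        Tendsto (fun T : ℝ≥0 => P {ω | ¬ (
          ConcaveOn ℝ U (Q (n T ω) ω) ∧
          φhat T ω ∈ U ∧
          IsMaxOn (Q (n T ω) ω) U (φhat T ω) ∧
          (∀ φ ∈ U, IsMaxOn (Q (n T ω) ω) U φ → φ = φhat T ω) ∧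
          gradient (Q (n T ω) ω) (φhat T ω) = 0)}) atTop (𝓝 0) ∧
        -- (ii) consistency
        TendstoInMeasure P φhat atTop (fun _ => φ₀) ∧
        -- (iii) asymptotic normality
        TendstoInDistribution (fun (T : ℝ≥0) ω => √(T : ℝ) • (φhat T ω - φ₀)) atTop id
          (fun _ => P) (multivariateGaussian 0 (c⁻¹ • (ΩI⁻¹ * ΩS * ΩI⁻¹))) := by
  have hQ_diff2 : ∀ m ω, ContDiff ℝ 2 (Q m ω) := fun m ω => (hQ_diff m ω).of_le (by norm_num)
  have hQ_d : ∀ m ω, Differentiable ℝ (Q m ω) := fun m ω =>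
    (hQ_diff m ω).differentiable (by norm_num)
  set A := Matrix.toEuclideanCLM (𝕜 := ℝ) ΩI
  obtain ⟨κ, hκ, hA⟩ := hΩI.exists_coercive
  have hAinv := hΩI.toEuclideanCLM_inv_apply
  let κ₂ : ℝ≥0 := ⟨κ / 2, by positivity⟩
  have hκ₂ : (κ₂ : ℝ) = κ / 2 := rfl
  have hκ₂κ : (κ₂ : ℝ) ≤ κ := by rw [hκ₂]; linarith
  -- the rescaled gradients, and the event that they are close to the linear map `A`
  let g : ℕ → Ω → EuclideanSpace ℝ (Fin k) → EuclideanSpace ℝ (Fin k) :=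
    fun m ω x => -(m : ℝ)⁻¹ • gradient (Q m ω) x
  have hgrad_meas : ∀ m x, Measurable fun ω => gradient (Q m ω) x := fun m x =>
    measurable_gradient_param (hQ_meas m) (hQ_d m) x
  have hg_meas : ∀ T x, Measurable fun ω => g (n T ω) ω x := fun T x =>
    Measurable.comp_random_index (f := fun m ω => g m ω x)
      (fun m => (hgrad_meas m x).const_smul (-(m : ℝ)⁻¹)) (hn.measurable T)
  have hg_cont : ∀ m ω, Continuous (g m ω) := fun m ω =>
    (continuous_const_smul (-(m : ℝ)⁻¹)).comp (continuous_gradient_of_contDiff (hQ_diff2 m ω))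
  let L : ℝ≥0 → ℝ → ℝ≥0 → Set Ω := fun ε r T =>
    {ω | ApproximatesLinearOn (g (n T ω) ω) A (Metric.ball φ₀ r) ε}
  have hL_meas : ∀ ε r T, MeasurableSet (L ε r T) := fun ε r T =>
    measurableSet_approximatesLinearOn (hg_meas T) (fun ω => hg_cont _ ω) A _ ε
  have hn_top : ∀ᵐ ω ∂P, Tendsto (fun T => n T ω) atTop atTop :=
    hC4.mono fun ω hω => tendsto_atTop_of_tendsto_div hc hω
  have hL : ∀ ε : ℝ≥0, 0 < ε → ∃ r > 0, Metric.ball φ₀ r ⊆ N ∧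
      ∀ r' ≤ r, Tendsto (fun T => P (L ε r' T)ᶜ) atTop (𝓝 0) := by
    intro ε hε
    obtain ⟨r, hr, hrN, h⟩ :=
      exists_ball_forall_eventually_approximatesLinearOn hΩI.isHermitian hN hτ_pos hε
    refine ⟨r, hr, hrN, fun r' hr' => tendsto_measure_compl_of_ae_eventually_mem (hL_meas _ _) ?_⟩
    filter_upwards [hC2, hC3_bound, hC3_lim, hn_top] with ω h2 h3 h4 h5
    refine (h5.eventually
      (h (fun m => Q m ω) (fun m => τ m ω) (fun m => hQ_diff m ω) h2 h3 h4)).mono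
      fun T hT => ?_
    exact ApproximatesLinearOn.mono_set (Metric.ball_subset_ball hr') hT
  have hn_one : Tendsto (fun T => P {ω | 1 ≤ n T ω}ᶜ) atTop (𝓝 0) :=
    tendsto_measure_compl_of_ae_eventually_mem
      (fun T => measurableSet_le measurable_const (hn.measurable T))
      (hn_top.mono fun ω hω => hω.eventually_ge_atTop 1)
  -- the normalized score at the random time
  let Y : ℝ≥0 → Ω → EuclideanSpace ℝ (Fin k) :=
    fun T ω => (√(T : ℝ) / n T ω) • gradient (Q (n T ω) ω) φ₀
  let c' : ℝ≥0 := ⟨c, hc.le⟩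
  have hY : TendstoInDistribution Y atTop
      (fun ω' => c⁻¹ • Matrix.toEuclideanCLM (𝕜 := ℝ) (CFC.sqrt ΩS) (B c' ω'))
      (fun _ => P) P' :=
    tendstoInDistribution_random_index (S := fun m ω => gradient (Q m ω) φ₀)
      (fun m => hgrad_meas m φ₀) (c := c') hc hC1
      (fun ω => ((Matrix.toEuclideanCLM (𝕜 := ℝ) (CFC.sqrt ΩS)).continuous.comp
        (hB.continuous_paths ω)).continuousAt)
      ((Matrix.toEuclideanCLM (𝕜 := ℝ) (CFC.sqrt ΩS)).continuous.measurable.comp_aemeasurable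
        (hB.aemeasurable c')) hn.measurable hC4
  have hYg : ∀ (T : ℝ≥0) ω, √(T : ℝ) • g (n T ω) ω φ₀ = -Y T ω := by
    intro T ω
    simp only [g, Y]
    rw [smul_smul, ← neg_smul]
    congr 1
    rw [div_eq_mul_inv]
    ring
  have hg₀ : TendstoInMeasure P (fun T ω => g (n T ω) ω φ₀) atTop (fun _ => 0) := by
    refine tendstoInMeasure_zero_of_negligible hY fun ε hε => ?_
    refine tendsto_const_nhds.congr' ?_
    filter_upwards [eventually_ge_atTop (Real.toNNReal (ε⁻¹ ^ 2)), eventually_gt_atTop 0]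
      with T hT hT0
    have hT0' : (0 : ℝ) < T := by exact_mod_cast hT0
    have h1 : ε⁻¹ ≤ √(T : ℝ) := Real.le_sqrt_of_sq_le (Real.toNNReal_le_iff_le_coe.1 hT)
    have h2 : 1 ≤ ε * √(T : ℝ) := by
      rw [← mul_inv_cancel₀ hε.ne']
      gcongr
    symm
    convert measure_empty (μ := P)
    refine Set.eq_empty_of_forall_notMem fun ω hω => ?_
    have h3 : ‖Y T ω‖ = √(T : ℝ) * ‖g (n T ω) ω φ₀‖ := by
      rw [← norm_neg, ← hYg, norm_smul, Real.norm_of_nonneg (Real.sqrt_nonneg _)]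
    have hω : ε * ‖Y T ω‖ < ‖g (n T ω) ω φ₀‖ := hω
    rw [h3] at hω
    nlinarith [norm_nonneg (g (n T ω) ω φ₀)]
  have hg₀' : ∀ ε > 0, Tendsto (fun T => P {ω | ε ≤ ‖g (n T ω) ω φ₀‖}) atTop (𝓝 0) := by
    intro ε hε
    simpa using tendstoInMeasure_iff_norm.1 hg₀ ε hε
  -- the neighbourhood `U` and the good events `G T`
  obtain ⟨r₁, hr₁, hr₁N, hLκ⟩ := hL κ₂ (half_pos hκ)
  obtain ⟨r₂, hr₂, hr₂Φ⟩ := Metric.mem_nhds_iff.1 (mem_interior_iff_mem_nhds.1 hφ₀)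
  set r := min r₁ r₂
  have hr : 0 < r := lt_min hr₁ hr₂
  have hφ₀U : φ₀ ∈ Metric.ball φ₀ r := Metric.mem_ball_self hr
  have hKU : Metric.closedBall φ₀ (r / 2) ⊆ Metric.ball φ₀ r :=
    Metric.closedBall_subset_ball (half_lt_self hr)
  let G : ℝ≥0 → Set Ω := fun T =>
    {ω | 1 ≤ n T ω} ∩ L κ₂ r T ∩ {ω | ‖g (n T ω) ω φ₀‖ < (κ - κ₂) * (r / 2)}
  have hG_meas : ∀ T, MeasurableSet (G T) := fun T =>
    ((measurableSet_le measurable_const (hn.measurable T)).inter (hL_meas _ _ _)).inter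
      (measurableSet_lt (hg_meas T φ₀).norm measurable_const)
  have hG : Tendsto (fun T => P (G T)ᶜ) atTop (𝓝 0) := by
    have h := (hn_one.add (hLκ r (min_le_left _ _))).add
      (hg₀' ((κ - κ₂) * (r / 2)) (by rw [hκ₂]; exact mul_pos (by linarith) (by linarith)))
    simp only [add_zero] at h
    refine tendsto_of_tendsto_of_tendsto_of_le_of_le tendsto_const_nhds h (fun _ => zero_le)
      fun T => ?_
    simp only [G, Set.compl_inter, Set.compl_ofPred, not_lt]
    exact (measure_union_le _ _).trans (add_le_add_left (measure_union_le _ _) _)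
  have hinj : ∀ T, ∀ ω ∈ G T, ∀ x ∈ Metric.ball φ₀ r, ∀ y ∈ Metric.ball φ₀ r,
      g (n T ω) ω x = 0 → g (n T ω) ω y = 0 → x = y := by
    intro T ω hω x hx y hy hx0 hy0
    have h := ApproximatesLinearOn.norm_sub_ge hω.1.2 hA hx hy
    rw [hx0, hy0, sub_self, norm_zero] at h
    have h' : 0 < κ - κ₂ := by rw [hκ₂]; linarith
    exact sub_eq_zero.1 (norm_le_zero_iff.1 (nonpos_of_mul_nonpos_right h h'))
  have hsel : ∀ T, ∃ z : Ω → EuclideanSpace ℝ (Fin k), Measurable z ∧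
      ∀ ω ∈ G T, z ω ∈ Metric.closedBall φ₀ (r / 2) ∧ g (n T ω) ω (z ω) = 0 := by
    intro T
    refine exists_measurable_zero (isCompact_closedBall φ₀ (r / 2))
      (Metric.mem_closedBall_self (by positivity)) (hg_meas T) (fun ω => hg_cont _ ω) (hG_meas T)
      (fun ω hω => ?_) fun ω hω x hx y hy => hinj T ω hω x (hKU hx) y (hKU hy)
    exact ApproximatesLinearOn.exists_eq_zero hω.1.2 hA hκ hAinv (by positivity) hKU
      (le_of_lt hω.2)
  choose φhat hφ_meas hφ using hsel
  have hdist : ∀ T, ∀ ω ∈ G T, κ / 2 * ‖φhat T ω - φ₀‖ ≤ ‖g (n T ω) ω φ₀‖ := by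
    intro T ω hω
    have h := ApproximatesLinearOn.norm_sub_ge hω.1.2 hA (hKU (hφ T ω hω).1) hφ₀U
    rw [(hφ T ω hω).2, zero_sub, norm_neg, hκ₂] at h
    linarith
  have hcons : ∀ ε > 0, Tendsto (fun T => P {ω | ε ≤ ‖φhat T ω - φ₀‖}) atTop (𝓝 0) := by
    intro ε hε
    have h := hG.add (hg₀' (κ / 2 * ε) (by positivity))
    simp only [add_zero] at h
    refine tendsto_of_tendsto_of_tendsto_of_le_of_le tendsto_const_nhds h (fun _ => zero_le)
      fun T => (measure_mono fun ω (hω : ε ≤ ‖φhat T ω - φ₀‖) => ?_).trans (measure_union_le _ _)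
    by_cases hωG : ω ∈ G T
    · exact Or.inr (le_trans (by gcongr) (hdist T ω hωG))
    · exact Or.inl hωG
  refine ⟨Metric.ball φ₀ r, Metric.isOpen_ball, hφ₀U,
    (Metric.ball_subset_ball (min_le_left _ _)).trans hr₁N,
    (Metric.ball_subset_ball (min_le_right _ _)).trans hr₂Φ, φhat, hφ_meas, ?_, ?_, ?_⟩
  · refine tendsto_of_tendsto_of_tendsto_of_le_of_le tendsto_const_nhds hG (fun _ => zero_le)
      fun T => measure_mono fun ω hω hωG => hω ?_
    have hn1 : (0 : ℝ) < (n T ω : ℝ)⁻¹ := inv_pos.2 (Nat.cast_pos.2 hωG.1.1)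
    have happ : ApproximatesLinearOn (fun x => -(n T ω : ℝ)⁻¹ • gradient (Q (n T ω) ω) x) A
      (Metric.ball φ₀ r) κ₂ := hωG.1.2
    have hgrad0 : gradient (Q (n T ω) ω) (φhat T ω) = 0 :=
      (smul_eq_zero.1 (hφ T ω hωG).2).resolve_left (neg_ne_zero.2 hn1.ne')
    have hφU := hKU (hφ T ω hωG).1
    refine ⟨happ.concaveOn_of_gradient hA hκ₂κ hn1 (hQ_d _ _) (convex_ball _ _), hφU,
      happ.isMaxOn_of_gradient_eq_zero hA hκ₂κ hn1 (hQ_d _ _) (convex_ball _ _) hφU hgrad0,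
      fun φ hφU' hmax => hinj T ω hωG φ hφU' _ hφU ?_ (hφ T ω hωG).2, hgrad0⟩
    have hfd := (hmax.isLocalMax (Metric.isOpen_ball.mem_nhds hφU')).fderiv_eq_zero
    simp only [g]
    rw [gradient, hfd, map_zero, smul_zero]
  · rw [tendstoInMeasure_iff_norm]
    exact hcons
  · -- `√T (φhat - φ₀)` differs negligibly from the linear image `A⁻¹ Y` of the score
    let Ai := Matrix.toEuclideanCLM (𝕜 := ℝ) ΩI⁻¹
    have hAY : TendstoInDistribution (fun T ω => Ai (Y T ω)) atTop
        (fun ω' => Ai (c⁻¹ • Matrix.toEuclideanCLM (𝕜 := ℝ) (CFC.sqrt ΩS) (B c' ω')))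
        (fun _ => P) P' := hY.continuous_comp Ai.continuous
    have hX_meas : ∀ T : ℝ≥0, Measurable fun ω => √(T : ℝ) • (φhat T ω - φ₀) := fun T =>
      (measurable_const_smul (√(T : ℝ))).comp ((hφ_meas T).sub_const φ₀)
    have hneg : TendstoInMeasure P
        ((fun (T : ℝ≥0) ω => √(T : ℝ) • (φhat T ω - φ₀)) - fun T ω => Ai (Y T ω)) atTop 0 := by
      refine tendstoInMeasure_zero_of_negligible hY fun δ hδ => ?_
      let ε : ℝ≥0 := ⟨δ * κ ^ 2 / 2, by positivity⟩
      obtain ⟨ρ, hρ, -, hLε⟩ := hL ε (by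
        change 0 < δ * κ ^ 2 / 2
        positivity)
      have hρr : 0 < min ρ r := lt_min hρ hr
      have h := (hG.add (hLε (min ρ r) (min_le_left _ _))).add (hcons (min ρ r) hρr)
      simp only [add_zero] at h
      refine tendsto_of_tendsto_of_tendsto_of_le_of_le tendsto_const_nhds h (fun _ => zero_le)
        fun T => le_trans (measure_mono fun ω hω => ?_) ((measure_union_le _ _).trans
          (add_le_add_left (measure_union_le _ _) _))
      by_contra hcon
      simp only [Set.mem_union, Set.mem_compl_iff, not_or, not_not, Set.mem_ofPred_eq,
        not_le] at hcon
      obtain ⟨⟨hωG, hωL⟩, hωρ⟩ := hcon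
      have hω : δ * ‖Y T ω‖ < ‖√(T : ℝ) • (φhat T ω - φ₀) - Ai (Y T ω)‖ := hω
      set X := √(T : ℝ) • (φhat T ω - φ₀) with hX
      have hsT := Real.sqrt_nonneg (T : ℝ)
      have hXn : ‖X‖ = √(T : ℝ) * ‖φhat T ω - φ₀‖ := by
        rw [hX, norm_smul, Real.norm_of_nonneg hsT]
      have hYn : ‖Y T ω‖ = √(T : ℝ) * ‖g (n T ω) ω φ₀‖ := by
        rw [← norm_neg, ← hYg, norm_smul, Real.norm_of_nonneg hsT]
      have h1 : κ / 2 * ‖X‖ ≤ ‖Y T ω‖ := by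
        rw [hXn, hYn]
        calc κ / 2 * (√(T : ℝ) * ‖φhat T ω - φ₀‖) = √(T : ℝ) * (κ / 2 * ‖φhat T ω - φ₀‖) := by ring
          _ ≤ _ := mul_le_mul_of_nonneg_left (hdist T ω hωG) hsT
      -- linearization of `0 = g φhat` around `φ₀`, multiplied by `√T`
      have h2 : ‖Y T ω - A X‖ ≤ ε * ‖X‖ := by
        have h3 := hωL _ (by rwa [Metric.mem_ball, dist_eq_norm]) φ₀ (Metric.mem_ball_self hρr)
        rw [(hφ T ω hωG).2, zero_sub] at h3
        have h4 : Y T ω - A X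
            = √(T : ℝ) • (-g (n T ω) ω φ₀ - A (φhat T ω - φ₀)) := by
          rw [smul_sub, smul_neg, hYg, neg_neg, hX, map_smul]
        rw [h4, norm_smul, Real.norm_of_nonneg hsT, hXn]
        calc _ ≤ √(T : ℝ) * (ε * ‖φhat T ω - φ₀‖) := mul_le_mul_of_nonneg_left h3 hsT
          _ = _ := by ring
      have h5 : κ * ‖X - Ai (Y T ω)‖ ≤ ‖Y T ω - A X‖ := by
        have h6 : A (X - Ai (Y T ω)) = -(Y T ω - A X) := by
          rw [map_sub, hAinv]
          abel
        have h7 := hA (X - Ai (Y T ω))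
        have h8 := real_inner_le_norm (X - Ai (Y T ω)) (A (X - Ai (Y T ω)))
        rw [h6, norm_neg] at h8
        rw [h6] at h7
        rcases (norm_nonneg (X - Ai (Y T ω))).eq_or_lt with h0 | h0
        · rw [← h0, mul_zero]
          exact norm_nonneg _
        · refine le_of_mul_le_mul_left ?_ h0
          nlinarith
      have h9 : κ * ‖X - Ai (Y T ω)‖ ≤ κ * (δ * ‖Y T ω‖) :=
        calc κ * ‖X - Ai (Y T ω)‖ ≤ δ * κ ^ 2 / 2 * ‖X‖ := h5.trans h2
          _ = κ * δ * (κ / 2 * ‖X‖) := by ring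
          _ ≤ κ * δ * ‖Y T ω‖ := by gcongr
          _ = _ := by ring
      exact absurd (le_of_mul_le_mul_left h9 hκ) (not_le.2 hω)
    have hfin := tendstoInDistribution_of_tendstoInMeasure_sub
      (fun (T : ℝ≥0) ω => √(T : ℝ) • (φhat T ω - φ₀)) _ hAY hneg
      (fun T => (hX_meas T).aemeasurable)
    have hlaw := hB.map_linear_eq_multivariateGaussian c' c⁻¹ hΩS hΩI
    have hcc : c⁻¹ ^ 2 * (c' : ℝ) = c⁻¹ := by
      change c⁻¹ ^ 2 * c = c⁻¹
      field_simp
    rw [hcc] at hlaw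
    refine ⟨hfin.forall_aemeasurable, aemeasurable_id, ?_⟩
    convert hfin.tendsto using 2
    refine congrArg 𝓝 (Subtype.ext ?_)
    simp only [Measure.map_id, map_smul, Ai]
    exact hlaw.symm
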